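/- Setting. Let $(\Omega,\mathcal F,\mathbb P)$ be a complete probability space, $V$ a separable real Banach space, and $\mathcal A: D(\mathcal A)\to 2^V$ a densely defined m-accretive operator; for $u\in V$ let $t\mapsto T_{\mathcal A}(t)u$, $t\ge 0$, be the unique mild solution of $0\in v'(t)+\mathcal A v(t)$, $v(0)=u$. Let $V_1,V_2\subseteq V$ be separable Banach spaces with continuous (linear) injections into $V$, both invariant under $T_{\mathcal A}(t)$ for all $t\ge 0$, and let $\kappa\in(0,\infty)$, $\rho\in(0,1)$ be such that for all $t\ge 0$ $$\|T_{\mathcal A}(t)v\|_{V_1}^\rho\le \max(-\kappa t+\|v\|_{V_1}^\rho,0)\ \ (v\in V_1),\qquad \|T_{\mathcal A}(t)v\|_{V_2}\le\|v\|_{V_2}\ \ (v\in V_2).$$ Let $(\eta_m)_{m\ge1}$ be i.i.d. $V$-valued and $(\beta_m)_{m\ge1}$ i.i.d. $(0,\infty)$-valued random variables, the two sequences being independent of each other, such that for all $m$: $\eta_m\in V_1\cap V_2$ almost surely; $\mathbb E\|\eta_m\|_{V_2}^4<\infty$; for some $\hat\varepsilon>0$, $\mathbb E\|\eta_m\|_{V_1}^{\rho(11+\hat\varepsilon)}<\infty$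 and $\mathbb E\beta_m^{11+\hat\varepsilon}<\infty$; and $-\kappa\,\mathbb E\beta_m+\mathbb E\|\eta_m\|_{V_1}^\rho<0$. Put $\alpha_0:=0$ and $\alpha_m:=\beta_1+\dots+\beta_m$. For a $V$-valued random variable $x$ put $X_{x,0}:=x$, $X_{x,m}:=T_{\mathcal A}(\beta_m)X_{x,m-1}+\eta_m$ for $m\ge 1$, and $$\mathbb X_x(t):=\sum_{m=0}^\infty T_{\mathcal A}\big(\max(t-\alpha_m,0)\big)(X_{x,m})\,\mathbf 1_{[\alpha_m,\alpha_{m+1})}(t),\quad t\ge 0.$$ Let $e_x(0):=0$ and, for $n\ge 1$, $e_x(n):=\min\{m\in\mathbb N:\ m>e_x(n-1),\ T_{\mathcal A}(\beta_m)X_{x,m-1}=0\}\in\mathbb N\cup\{\infty\}$. Call $x$ an independent initial value leading to extinction if $x\in V_1\cap V_2$ almost surely, $\mathbb E\|x\|_{V_1}^{2\rho}<\infty$, and $x$ is independent of $((\beta_m)_m,(\eta_m)_m)$. Proposition. Let $W$ be a separable Banach space and let $\Xi:V\to W$ be Borel measurable with $\|\Xi(v)\|_W\le c_1\|v\|_{V_2}+c_2$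 for all $v\in V_2$ and some constants $c_1,c_2\in[0,\infty)$. Let $x$ be an independent initial value leading to extinction. Then, almost surely, $e_x(n)<\infty$ for all $n$ and the Bochner integrals $\int_{\alpha_{e_x(n)}}^{\alpha_{e_x(n+1)}}\Xi(\mathbb X_x(\tau))\,d\tau$ exist for all $n\ge 0$, and the sequence $$\left(\int_{\alpha_{e_x(n)}}^{\alpha_{e_x(n+1)}}\Xi(\mathbb X_x(\tau))\,d\tau\right)_{n\ge 1}$$ is i.i.d. Moreover, if $\overline x$ is a $V$-valued random variable on $\Omega$ that is distributed like $\eta_1$ and independent of $((\beta_m)_m,(\eta_m)_m)$, then almost surely $e_{\overline x}(1)<\infty$ and $\int_0^{\alpha_{e_{\overline x}(1)}}\Xi(\mathbb X_{\overline x}(\tau))\,d\tau$ exists, and for every $n\ge 1$ $$\int_{\alpha_{e_x(n)}}^{\alpha_{e_x(n+1)}}\Xi(\mathbb X_x(\tau))\,d\tau\ =\ \int_0^{\alpha_{e_{\overline x}(1)}}\Xi(\mathbb X_{\overline x}(\tau))\,d\tau\quad\text{in distribution.}$$ -/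

import Mathlib

open MeasureTheory ProbabilityTheory Set

noncomputable section

namespace AccretiveJump

/-! ### Accretive operators, mild solutions and the associated semigroup

A multivalued operator on `U` is identified with its graph, a subset of `U × U`. -/

section Semigroup

variable {U : Type*} [NormedAddCommGroup U] [NormedSpace ℝ U]

/-- The domain of a multivalued operator. -/
def opDomain (A : Set (U × U)) : Set U := {u | ∃ w, (u, w) ∈ A}

/-- `‖u₁ - u₂‖ ≤ ‖u₁ - u₂ + a (w₁ - w₂)‖` for all `a > 0` and `(u₁, w₁), (u₂, w₂) ∈ A`. -/
def IsAccretive (A : Set (U × U)) : Prop :=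
  ∀ a : ℝ, 0 < a → ∀ u₁ w₁ u₂ w₂ : U, (u₁, w₁) ∈ A → (u₂, w₂) ∈ A →
    ‖u₁ - u₂‖ ≤ ‖(u₁ - u₂) + a • (w₁ - w₂)‖

/-- `A` is accretive and `Id + a A` is onto for every `a > 0`. -/
def IsMAccretive (A : Set (U × U)) : Prop :=
  IsAccretive A ∧ ∀ a : ℝ, 0 < a → ∀ y : U, ∃ u w : U, (u, w) ∈ A ∧ u + a • w = y

/-- `A` is densely defined. -/
def IsDenselyDefined (A : Set (U × U)) : Prop := Dense (opDomain A)

/-- An `ε`-approximate solution of `0 ∈ v' + A v` on `[0, S]`: a partition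
`0 = t 0 < ⋯ < t N ≤ S` of mesh less than `ε` with `S - t N < ε`, values `z 0, …, z N`, and errors
`f 1, …, f N` with `∑ (t i - t (i-1)) ‖f i‖ < ε`, such that
`f i ∈ (z i - z (i-1)) / (t i - t (i-1)) + A (z i)` (implicit Euler scheme). -/
structure IsApproxSolution (A : Set (U × U)) (S ε : ℝ) (N : ℕ) (t : ℕ → ℝ) (z f : ℕ → U) :
    Prop where
  start : t 0 = 0
  step_pos : ∀ i < N, t i < t (i + 1)
  step_lt : ∀ i < N, t (i + 1) - t i < ε
  le_end : t N ≤ S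
  end_lt : S - t N < ε
  error_lt : ∑ i ∈ Finset.range N, (t (i + 1) - t i) * ‖f (i + 1)‖ < ε
  euler : ∀ i < N, (z (i + 1), f (i + 1) - (t (i + 1) - t i)⁻¹ • (z (i + 1) - z i)) ∈ A

/-- `v` is a mild solution of `0 ∈ v' + A v`, `v(0) = u₀` on `[0, S]`: it is continuous and, for
every `ε > 0`, it is uniformly `ε`-close on `[0, t N]` to the step function
(`z 0` at `0`, `z i` on `(t (i-1), t i]`) of an `ε`-approximate solution. -/
def IsMildSolutionOn (A : Set (U × U)) (u₀ : U) (S : ℝ) (v : ℝ → U) : Prop :=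
  ContinuousOn v (Icc 0 S) ∧ v 0 = u₀ ∧
    ∀ ε : ℝ, 0 < ε → ∃ (N : ℕ) (t : ℕ → ℝ) (z f : ℕ → U), IsApproxSolution A S ε N t z f ∧
      ‖v 0 - z 0‖ ≤ ε ∧ ∀ i < N, ∀ s ∈ Ioc (t i) (t (i + 1)), ‖v s - z (i + 1)‖ ≤ ε

/-- Mild solution on `[0, ∞)`: mild solution on `[0, S]` for every `S > 0`. -/
def IsMildSolution (A : Set (U × U)) (u₀ : U) (v : ℝ → U) : Prop :=
  ∀ S : ℝ, 0 < S → IsMildSolutionOn A u₀ S v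

open Classical in
/-- `semigroup A t u` is `T_A(t) u`: the value at time `t ≥ 0` of the mild solution of
`0 ∈ v' + A v`, `v(0) = u`. (For `A` m-accretive and densely defined the mild solution exists and
is unique on `[0, ∞)`; the value `0` is only used when there is none.) -/
def semigroup (A : Set (U × U)) (t : ℝ) (u : U) : U :=
  if h : ∃ v : ℝ → U, IsMildSolution A u v then h.choose t else 0

end Semigroup

/-- For an injection `ι : E → V`, the norm of `E` carried over to `V`: it is `‖w‖` at `ι w`
and `0` outside the range of `ι`. -/
def subNorm {E V : Type*} [NormedAddCommGroup E] (ι : E → V) : V → ℝ :=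
  Function.extend ι (fun w => ‖w‖) 0

/-! ### The generated sequence and process

The sequences `β`, `η` are indexed from `0`: `β m`, `η m` stand for `β_{m+1}`, `η_{m+1}`. -/

section Generated

variable {Ω V : Type*} [NormedAddCommGroup V] [NormedSpace ℝ V]

/-- `α_m = β_1 + ⋯ + β_m`. -/
def jumpTime (β : ℕ → Ω → ℝ) (m : ℕ) (ω : Ω) : ℝ := ∑ k ∈ Finset.range m, β k ω

/-- The sequence generated by `(β, η, x, A)`. -/
def genSeq (A : Set (V × V)) (β : ℕ → Ω → ℝ) (η : ℕ → Ω → V) (x : Ω → V) : ℕ → Ω → V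
  | 0, ω => x ω
  | m + 1, ω => semigroup A (β m ω) (genSeq A β η x m ω) + η m ω

/-- The process generated by `(β, η, x, A)`:
`X_x(t) = ∑_m T_A((t - α_m)₊) (X_{x,m}) 1_{[α_m, α_{m+1})}(t)`. -/
def genProcess (A : Set (V × V)) (β : ℕ → Ω → ℝ) (η : ℕ → Ω → V) (x : Ω → V) (t : ℝ) (ω : Ω) : V :=
  ∑' m : ℕ, (Ico (jumpTime β m ω) (jumpTime β (m + 1) ω)).indicator
    (fun s => semigroup A (max (s - jumpTime β m ω) 0) (genSeq A β η x m ω)) t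

/-- The extinction times: `e_x(0) = 0` and `e_x(n+1)` is the least `m ≥ 1` with `m > e_x(n)` and
`T_A(β_m) X_{x,m-1} = 0` (written `m + 1` below), or `∞` if there is none. -/
def extinctionTime (A : Set (V × V)) (β : ℕ → Ω → ℝ) (η : ℕ → Ω → V) (x : Ω → V) :
    ℕ → Ω → ℕ∞
  | 0, _ => 0
  | n + 1, ω => sInf {j : ℕ∞ | ∃ m : ℕ, j = ((m + 1 : ℕ) : ℕ∞) ∧
      extinctionTime A β η x n ω < j ∧ semigroup A (β m ω) (genSeq A β η x m ω) = 0}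

/-- `α_{e_x(n)}`, meaningful where `e_x(n) < ∞`. -/
def extinctionInstant (A : Set (V × V)) (β : ℕ → Ω → ℝ) (η : ℕ → Ω → V) (x : Ω → V) (n : ℕ)
    (ω : Ω) : ℝ :=
  jumpTime β (extinctionTime A β η x n ω).toNat ω

end Generated

/-! ### Standing assumptions -/

section Assumptions

variable {Ω V V₁ V₂ W : Type*}
  [NormedAddCommGroup V] [NormedSpace ℝ V]
  [NormedAddCommGroup V₁] [NormedSpace ℝ V₁]
  [NormedAddCommGroup V₂] [NormedSpace ℝ V₂]
  [NormedAddCommGroup W]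

/-- The functional analytic assumption; the subspaces `V₁, V₂` of `V` are given by continuous linear
injections `ι₁, ι₂`. -/
structure SemigroupAssumption (A : Set (V × V)) (ι₁ : V₁ →L[ℝ] V) (ι₂ : V₂ →L[ℝ] V) (κ ρ : ℝ) :
    Prop where
  inj₁ : Function.Injective ι₁
  inj₂ : Function.Injective ι₂
  kappa_pos : 0 < κ
  rho_mem : ρ ∈ Ioo (0 : ℝ) 1
  invariant₁ : ∀ t : ℝ, 0 ≤ t → ∀ v ∈ range ι₁, semigroup A t v ∈ range ι₁
  invariant₂ : ∀ t : ℝ, 0 ≤ t → ∀ v ∈ range ι₂, semigroup A t v ∈ range ι₂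
  decay₁ : ∀ t : ℝ, 0 ≤ t → ∀ v ∈ range ι₁,
    subNorm ι₁ (semigroup A t v) ^ ρ ≤ max (-κ * t + subNorm ι₁ v ^ ρ) 0
  contract₂ : ∀ t : ℝ, 0 ≤ t → ∀ v ∈ range ι₂, subNorm ι₂ (semigroup A t v) ≤ subNorm ι₂ v

/-- The stochastic assumptions on the noise `(β_m), (η_m)`. -/
structure NoiseAssumption [MeasurableSpace V] [MeasurableSpace Ω] (μ : Measure Ω)
    (ι₁ : V₁ →L[ℝ] V) (ι₂ : V₂ →L[ℝ] V) (κ ρ : ℝ) (β : ℕ → Ω → ℝ) (η : ℕ → Ω → V) : Prop where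
  measurable_beta : ∀ m, Measurable (β m)
  measurable_eta : ∀ m, Measurable (η m)
  beta_pos : ∀ m ω, 0 < β m ω
  indep_beta : iIndepFun β μ
  ident_beta : ∀ m, IdentDistrib (β m) (β 0) μ μ
  indep_eta : iIndepFun η μ
  ident_eta : ∀ m, IdentDistrib (η m) (η 0) μ μ
  indep : IndepFun (fun ω m => η m ω) (fun ω m => β m ω) μ
  eta_mem₁ : ∀ m, ∀ᵐ ω ∂μ, η m ω ∈ range ι₁
  eta_mem₂ : ∀ m, ∀ᵐ ω ∂μ, η m ω ∈ range ι₂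
  moment_eta₂ : ∀ m, Integrable (fun ω => subNorm ι₂ (η m ω) ^ 4) μ
  moments : ∃ ε : ℝ, 0 < ε ∧ ∀ m,
    Integrable (fun ω => subNorm ι₁ (η m ω) ^ (ρ * (11 + ε))) μ ∧
    Integrable (fun ω => β m ω ^ (11 + ε)) μ
  drift : ∀ m, -κ * (∫ ω, β m ω ∂μ) + (∫ ω, subNorm ι₁ (η m ω) ^ ρ ∂μ) < 0

/-- `Ξ : V → W` is measurable and sublinear w.r.t. the norm of `V₂`. -/
structure IsSubLinear [MeasurableSpace V] [MeasurableSpace W] (ι₂ : V₂ →L[ℝ] V) (Ξ : V → W) :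
    Prop where
  measurable : Measurable Ξ
  bound : ∃ c₁ c₂ : ℝ, 0 ≤ c₁ ∧ 0 ≤ c₂ ∧ ∀ v ∈ range ι₂, ‖Ξ v‖ ≤ c₁ * subNorm ι₂ v + c₂

/-- `x` is independent of `((β_m), (η_m))` jointly. -/
def IndepOfNoise [MeasurableSpace V] [MeasurableSpace Ω] (μ : Measure Ω)
    (β : ℕ → Ω → ℝ) (η : ℕ → Ω → V) (x : Ω → V) : Prop :=
  IndepFun x (fun ω => ((fun m => β m ω, fun m => η m ω) : (ℕ → ℝ) × (ℕ → V))) μ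

/-- `x` is an independent initial value leading to extinction. -/
structure IsIndepInitial [MeasurableSpace V] [MeasurableSpace Ω] (μ : Measure Ω)
    (ι₁ : V₁ →L[ℝ] V) (ι₂ : V₂ →L[ℝ] V) (ρ : ℝ) (β : ℕ → Ω → ℝ) (η : ℕ → Ω → V) (x : Ω → V) :
    Prop where
  measurable : Measurable x
  mem₁ : ∀ᵐ ω ∂μ, x ω ∈ range ι₁
  mem₂ : ∀ᵐ ω ∂μ, x ω ∈ range ι₂
  moment : Integrable (fun ω => subNorm ι₁ (x ω) ^ (2 * ρ)) μ
  indep : IndepOfNoise μ β η x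

end Assumptions

end AccretiveJump

end

open AccretiveJump

/-! Pair each jump with the waiting time that follows it: the inputs are (x, β_1), (η_1, β_2), (η_2,
β_3), and so on. They are independent, and identically distributed from the second one on. The state
of the chain is a function of the inputs read so far. If the state is 0 at the end of a waiting
time, the next state is the next jump alone, so the chain starts afresh from the remaining inputs
(`chain_shift`). The first extinction index is a stopping index, hence the inputs after it are again
i.i.d. and independent of those before it (`measure_regeneration`). The integral over a cycle is one
fixed measurable functional, `cycleIntegral`, of the inputs of that cycle, so the integrals from the
second cycle on are i.i.d. (`iIndepFun_cycles`). Started from a copy of η_1, the inputs are i.i.d.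
from index 0 on, so already the first cycle has the common law.

Extinction recurs because ‖·‖_{V₁}^ρ is subadditive: without extinction it would be bounded by a
random walk of negative drift, which tends to −∞ by the law of large numbers
(`IsGoodPath.exists_isExtinct`, `NoiseAssumption.tendsto_drift`).

All this needs the semigroup to be jointly measurable (`measurable_flow`). Kobayashi's estimate
makes mild solutions contractive in the initial value, so the flow is continuous on the closed set
of initial values that have a mild solution, and it is 0 elsewhere. -/

noncomputable section

namespace AccretiveJump

open Filter Topology

/-! ### Mild solutions: contractivity, closed domain, measurability of the flow. -/

section MildSolutions

variable {U : Type*} [NormedAddCommGroup U] [NormedSpace ℝ U] {A : Set (U × U)}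

/-- Comparison of one implicit Euler step of size `δ` with another one of size `δ'`. -/
lemma IsAccretive.euler_step (hA : IsAccretive A) {δ δ' : ℝ} (hδ : 0 < δ) (hδ' : 0 < δ')
    {z₀ z₁ f y₀ y₁ g : U} (hz : (z₁, f - δ⁻¹ • (z₁ - z₀)) ∈ A)
    (hy : (y₁, g - δ'⁻¹ • (y₁ - y₀)) ∈ A) :
    ‖z₁ - y₁‖ ≤ δ' / (δ + δ') * ‖z₀ - y₁‖ + δ / (δ + δ') * ‖z₁ - y₀‖ +
      δ * δ' / (δ + δ') * (‖f‖ + ‖g‖) := by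
  have hs : 0 < δ + δ' := by positivity
  -- With λ = δδ'/(δ+δ') one has λ/δ + λ/δ' = 1, so the right side becomes a convex combination of
  -- z₀ - y₁ and z₁ - y₀ plus an error.
  have h := hA (δ * δ' / (δ + δ')) (by positivity) _ _ _ _ hz hy
  have e : z₁ - y₁ + (δ * δ' / (δ + δ')) • (f - δ⁻¹ • (z₁ - z₀) - (g - δ'⁻¹ • (y₁ - y₀))) =
      (δ' / (δ + δ')) • (z₀ - y₁) + (δ / (δ + δ')) • (z₁ - y₀) +
        (δ * δ' / (δ + δ')) • (f - g) := by
    match_scalars <;> field_simp <;> ring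
  rw [e] at h
  refine h.trans (norm_add₃_le.trans ?_)
  rw [norm_smul_of_nonneg (by positivity), norm_smul_of_nonneg (by positivity),
    norm_smul_of_nonneg (by positivity)]
  gcongr
  exact norm_sub_le _ _

/-- Comparison of one implicit Euler step with a point of the operator. -/
lemma IsAccretive.euler_step_point (hA : IsAccretive A) {δ : ℝ} (hδ : 0 < δ)
    {z₀ z₁ f p q : U} (hz : (z₁, f - δ⁻¹ • (z₁ - z₀)) ∈ A) (hp : (p, q) ∈ A) :
    ‖z₁ - p‖ ≤ ‖z₀ - p‖ + δ * ‖f‖ + δ * ‖q‖ := by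
  have h := hA δ hδ _ _ _ _ hz hp
  have e : z₁ - p + δ • (f - δ⁻¹ • (z₁ - z₀) - q) = z₀ - p + δ • f - δ • q := by
    match_scalars <;> field_simp
    ring
  rw [e] at h
  refine h.trans ((norm_sub_le _ _).trans ?_)
  rw [norm_smul_of_nonneg hδ.le]
  gcongr
  refine (norm_add_le _ _).trans ?_
  rw [norm_smul_of_nonneg hδ.le]

/-- The accumulated error of an Euler scheme up to step `i`. -/
def errorSum (t : ℕ → ℝ) (f : ℕ → U) (i : ℕ) : ℝ :=
  ∑ k ∈ Finset.range i, (t (k + 1) - t k) * ‖f (k + 1)‖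

/-- The sum of the squared step sizes up to step `i`. -/
def squareSum (t : ℕ → ℝ) (i : ℕ) : ℝ := ∑ k ∈ Finset.range i, (t (k + 1) - t k) ^ 2

lemma squareSum_nonneg (t : ℕ → ℝ) (i : ℕ) : 0 ≤ squareSum t i :=
  Finset.sum_nonneg fun _ _ => sq_nonneg _

variable {S ε : ℝ} {N : ℕ} {t : ℕ → ℝ} {z f : ℕ → U}

lemma IsApproxSolution.errorSum_le (h : IsApproxSolution A S ε N t z f) {i : ℕ} (hi : i ≤ N) :
    errorSum t f i ≤ ε := by
  refine le_trans ?_ h.error_lt.le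
  refine Finset.sum_le_sum_of_subset_of_nonneg (Finset.range_mono hi) fun k hk _ => ?_
  exact mul_nonneg (sub_nonneg.2 (h.step_pos k (Finset.mem_range.1 hk)).le) (norm_nonneg _)

lemma IsApproxSolution.time_le (h : IsApproxSolution A S ε N t z f) {i : ℕ} (hi : i ≤ N) :
    t i ≤ t N := by
  induction hi using Nat.decreasingInduction with
  | self => exact le_rfl
  | of_succ k hk ih => exact (h.step_pos k hk).le.trans ih

/-- Each squared step is at most ε times the step, and the steps telescope. -/
lemma IsApproxSolution.squareSum_le (h : IsApproxSolution A S ε N t z f) {i : ℕ} (hi : i ≤ N) :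
    squareSum t i ≤ ε * S := by
  have hN : ∀ i ≤ N, squareSum t i ≤ ε * t i := by
    intro i
    induction i with
    | zero => simp [squareSum, h.start]
    | succ i ih =>
      intro hi
      have h1 := h.step_pos i hi
      have h2 := h.step_lt i hi
      have h3 := ih (by omega)
      rw [squareSum, Finset.sum_range_succ, ← squareSum]
      nlinarith
  rcases Nat.eq_zero_or_pos N with h0 | h0
  · subst h0
    obtain rfl : i = 0 := by omega
    have h1 := h.end_lt
    have h2 := h.le_end
    rw [h.start] at h1 h2
    simp only [squareSum, Finset.range_zero, Finset.sum_empty]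
    nlinarith
  · have hε : 0 < ε := by linarith [h.step_pos 0 h0, h.step_lt 0 h0]
    exact (hN i hi).trans (mul_le_mul_of_nonneg_left ((h.time_le hi).trans h.le_end) hε.le)

lemma IsApproxSolution.norm_sub_point_le (hA : IsAccretive A) (h : IsApproxSolution A S ε N t z f)
    {p q : U} (hp : (p, q) ∈ A) {i : ℕ} (hi : i ≤ N) :
    ‖z i - p‖ ≤ ‖z 0 - p‖ + errorSum t f i + t i * ‖q‖ := by
  induction i with
  | zero => simp [errorSum, h.start]
  | succ i ih =>
    have h1 := hA.euler_step_point (sub_pos.2 (h.step_pos i hi)) (h.euler i hi) hp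
    have h2 := ih (by omega)
    rw [errorSum, Finset.sum_range_succ, ← errorSum]
    linarith

/-- Concavity of the square root; it closes the double induction in Kobayashi's estimate. -/
lemma weighted_sqrt_le {a b x y : ℝ} (ha : 0 ≤ a) (hb : 0 ≤ b) (hab : a + b = 1)
    (hx : 0 ≤ x) (hy : 0 ≤ y) : a * √x + b * √y ≤ √(a * x + b * y) := by
  apply Real.le_sqrt_of_sq_le
  obtain rfl : b = 1 - a := by linarith
  have h1 := Real.sq_sqrt hx
  have h2 := Real.sq_sqrt hy
  nlinarith [mul_nonneg (mul_nonneg ha hb) (sq_nonneg (√x - √y))]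

/-- Kobayashi's estimate for two implicit Euler schemes. -/
lemma IsApproxSolution.norm_sub_le (hA : IsAccretive A) (h : IsApproxSolution A S ε N t z f)
    {S' ε' : ℝ} {M : ℕ} {s : ℕ → ℝ} {y g : ℕ → U} (h' : IsApproxSolution A S' ε' M s y g)
    {p q : U} (hp : (p, q) ∈ A) {i : ℕ} (hi : i ≤ N) {j : ℕ} (hj : j ≤ M) :
    ‖z i - y j‖ ≤ ‖z 0 - p‖ + ‖y 0 - p‖ +
      √((t i - s j) ^ 2 + squareSum t i + squareSum s j) * ‖q‖ +
      errorSum t f i + errorSum s g j := by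
  induction i generalizing j with
  | zero =>
    have h1 := h'.norm_sub_point_le hA hp hj
    have h2 : ‖z 0 - y j‖ ≤ ‖z 0 - p‖ + ‖y j - p‖ := by
      rw [norm_sub_rev (y j)]; exact norm_sub_le_norm_sub_add_norm_sub _ _ _
    have h3 : s j ≤ √((t 0 - s j) ^ 2 + squareSum t 0 + squareSum s j) := by
      refine Real.le_sqrt_of_sq_le ?_
      rw [h.start]
      nlinarith [squareSum_nonneg t 0, squareSum_nonneg s j]
    have h4 := mul_le_mul_of_nonneg_right h3 (norm_nonneg q)
    have h5 : errorSum t f 0 = 0 := by simp [errorSum]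
    linarith
  | succ i ih =>
    induction j with
    | zero =>
      have h1 := h.norm_sub_point_le hA hp hi
      have h2 : ‖z (i + 1) - y 0‖ ≤ ‖z (i + 1) - p‖ + ‖y 0 - p‖ := by
        rw [norm_sub_rev (y 0)]; exact norm_sub_le_norm_sub_add_norm_sub _ _ _
      have h3 : t (i + 1) ≤
          √((t (i + 1) - s 0) ^ 2 + squareSum t (i + 1) + squareSum s 0) := by
        refine Real.le_sqrt_of_sq_le ?_
        rw [h'.start]
        nlinarith [squareSum_nonneg t (i + 1), squareSum_nonneg s 0]
      have h4 := mul_le_mul_of_nonneg_right h3 (norm_nonneg q)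
      have h5 : errorSum s g 0 = 0 := by simp [errorSum]
      linarith
    | succ j ihj =>
      have hδ := sub_pos.2 (h.step_pos i hi)
      have hδ' := sub_pos.2 (h'.step_pos j hj)
      have h1 := hA.euler_step hδ hδ' (h.euler i hi) (h'.euler j hj)
      have h2 := ih (by omega) hj
      have h3 := ihj (by omega)
      have e1 : errorSum t f (i + 1) = errorSum t f i + (t (i + 1) - t i) * ‖f (i + 1)‖ :=
        Finset.sum_range_succ _ _
      have e2 : errorSum s g (j + 1) = errorSum s g j + (s (j + 1) - s j) * ‖g (j + 1)‖ :=
        Finset.sum_range_succ _ _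
      have d1 : squareSum t (i + 1) = squareSum t i + (t (i + 1) - t i) ^ 2 :=
        Finset.sum_range_succ _ _
      have d2 : squareSum s (j + 1) = squareSum s j + (s (j + 1) - s j) ^ 2 :=
        Finset.sum_range_succ _ _
      have n1 := squareSum_nonneg t i
      have n2 := squareSum_nonneg s j
      have n3 := squareSum_nonneg t (i + 1)
      have n4 := squareSum_nonneg s (j + 1)
      set δ := t (i + 1) - t i with hδdef
      set δ' := s (j + 1) - s j with hδ'def
      have hs : 0 < δ + δ' := by positivity
      set a := δ' / (δ + δ') with ha
      set b := δ / (δ + δ') with hb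
      have ha0 : 0 ≤ a := by positivity
      have hb0 : 0 ≤ b := by positivity
      have hab : a + b = 1 := by rw [ha, hb]; field_simp; ring
      have hc : δ * δ' / (δ + δ') = a * δ := by rw [ha]; ring
      have hc' : a * δ = b * δ' := by rw [ha, hb]; ring
      have hw := weighted_sqrt_le ha0 hb0 hab
        (by positivity : 0 ≤ (t i - s (j + 1)) ^ 2 + squareSum t i + squareSum s (j + 1))
        (by positivity : 0 ≤ (t (i + 1) - s j) ^ 2 + squareSum t (i + 1) + squareSum s j)
      -- The cross terms of the expanded squares cancel by `hc'`, and since a + b = 1 what remains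
      -- of them completes `squareSum` by exactly δ² + δ'².
      have hr : a * ((t i - s (j + 1)) ^ 2 + squareSum t i + squareSum s (j + 1)) +
          b * ((t (i + 1) - s j) ^ 2 + squareSum t (i + 1) + squareSum s j) =
          (t (i + 1) - s (j + 1)) ^ 2 + squareSum t (i + 1) + squareSum s (j + 1) := by
        have k1 : t i = t (i + 1) - δ := by rw [hδdef]; ring
        have k2 : s j = s (j + 1) - δ' := by rw [hδ'def]; ring
        rw [d1, d2, k1, k2]
        have hb1 : b = 1 - a := by linarith
        rw [hb1] at hc' ⊢
        linear_combination (-2 * (t (i + 1) - s (j + 1))) * hc'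
      rw [hr] at hw
      rw [hc] at h1
      have hq := mul_le_mul_of_nonneg_right hw (norm_nonneg q)
      have m2 := mul_le_mul_of_nonneg_left h2 ha0
      have m3 := mul_le_mul_of_nonneg_left h3 hb0
      rw [e1] at m3 ⊢
      rw [e2] at m2 ⊢
      refine h1.trans ((add_le_add_left (add_le_add m2 m3) _).trans ?_)
      have hb1 : b = 1 - a := by linarith
      have hc2 : a * δ * ‖g (j + 1)‖ = b * δ' * ‖g (j + 1)‖ := by rw [hc']
      rw [hb1] at hq hc2 ⊢
      nlinarith [hq, hc2]

lemma IsApproxSolution.exists_mem_Ioc (h : IsApproxSolution A S ε N t z f) {r : ℝ} (hr : 0 < r)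
    (hrN : r ≤ t N) : ∃ i < N, r ∈ Ioc (t i) (t (i + 1)) := by
  classical
  have hex : ∃ i, r ≤ t i := ⟨N, hrN⟩
  have h0 : Nat.find hex ≠ 0 := fun h0 => by
    have := Nat.find_spec hex
    rw [h0, h.start] at this
    linarith
  obtain ⟨i, hi⟩ := Nat.exists_eq_succ_of_ne_zero h0
  refine ⟨i, ?_, not_le.1 (Nat.find_min hex (by omega)), ?_⟩
  · have := Nat.find_min' hex hrN
    omega
  · have := Nat.find_spec hex
    rwa [hi] at this

/-- Mild solutions depend contractively on the initial value. -/
lemma IsMildSolution.norm_sub_le (hA : IsAccretive A) (hd : IsDenselyDefined A) {u u' : U}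
    {v v' : ℝ → U} (hv : IsMildSolution A u v) (hv' : IsMildSolution A u' v') {r : ℝ}
    (hr : 0 ≤ r) : ‖v r - v' r‖ ≤ ‖u - u'‖ := by
  rcases hr.eq_or_lt with rfl | hr
  · rw [(hv 1 one_pos).2.1, (hv' 1 one_pos).2.1]
  have key : ∀ p q, (p, q) ∈ A → ‖v r - v' r‖ ≤ ‖u - p‖ + ‖u' - p‖ := by
    intro p q hp
    -- The 6ε collects, for each of the two schemes, the errors at time 0, at time r and in the
    -- Euler steps. As ε < 1, the horizon r + 1 ensures that both partitions reach r.
    have hε : ∀ ε ∈ Ioo (0 : ℝ) 1, ‖v r - v' r‖ ≤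
        ‖u - p‖ + ‖u' - p‖ + 6 * ε + √(ε ^ 2 + 2 * (ε * (r + 1))) * ‖q‖ := by
      rintro ε ⟨hε0, hε1⟩
      obtain ⟨N, t, z, f, ha, hz0, hz⟩ := (hv (r + 1) (by linarith)).2.2 ε hε0
      obtain ⟨M, s, y, g, ha', hy0, hy⟩ := (hv' (r + 1) (by linarith)).2.2 ε hε0
      obtain ⟨i, hi, hri⟩ := ha.exists_mem_Ioc hr (by linarith [ha.end_lt])
      obtain ⟨j, hj, hrj⟩ := ha'.exists_mem_Ioc hr (by linarith [ha'.end_lt])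
      have h1 := ha.norm_sub_le hA ha' hp (i := i + 1) hi (j := j + 1) hj
      have h2 := hz i hi r hri
      have h3 := hy j hj r hrj
      rw [(hv 1 one_pos).2.1] at hz0
      rw [(hv' 1 one_pos).2.1] at hy0
      have h4 : ‖z 0 - p‖ ≤ ‖u - z 0‖ + ‖u - p‖ := by
        rw [norm_sub_rev u]; exact norm_sub_le_norm_sub_add_norm_sub _ _ _
      have h5 : ‖y 0 - p‖ ≤ ‖u' - y 0‖ + ‖u' - p‖ := by
        rw [norm_sub_rev u']; exact norm_sub_le_norm_sub_add_norm_sub _ _ _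
      have h6 : ‖v r - v' r‖ ≤ ‖v r - z (i + 1)‖ + ‖z (i + 1) - y (j + 1)‖ +
          ‖v' r - y (j + 1)‖ := by
        rw [norm_sub_rev (v' r)]
        calc ‖v r - v' r‖ = ‖(v r - z (i + 1)) + (z (i + 1) - y (j + 1)) + (y (j + 1) - v' r)‖ := by
              congr 1; abel
          _ ≤ _ := norm_add₃_le
      have h7 : √((t (i + 1) - s (j + 1)) ^ 2 + squareSum t (i + 1) + squareSum s (j + 1)) ≤
          √(ε ^ 2 + 2 * (ε * (r + 1))) := by
        apply Real.sqrt_le_sqrt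
        have k1 := ha.squareSum_le (i := i + 1) hi
        have k2 := ha'.squareSum_le (i := j + 1) hj
        have k3 : (t (i + 1) - s (j + 1)) ^ 2 ≤ ε ^ 2 := by
          apply sq_le_sq'
          · linarith [ha'.step_lt j hj, hri.1, hri.2, hrj.1, hrj.2]
          · linarith [ha.step_lt i hi, hri.1, hri.2, hrj.1, hrj.2]
        linarith
      have h8 := mul_le_mul_of_nonneg_right h7 (norm_nonneg q)
      have h9 := ha.errorSum_le (i := i + 1) hi
      have h10 := ha'.errorSum_le (i := j + 1) hj
      linarith
    have hlim : Tendsto (fun ε : ℝ => ‖u - p‖ + ‖u' - p‖ + 6 * ε +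
        √(ε ^ 2 + 2 * (ε * (r + 1))) * ‖q‖) (𝓝[>] 0) (𝓝 (‖u - p‖ + ‖u' - p‖)) := by
      have : Continuous (fun ε : ℝ => ‖u - p‖ + ‖u' - p‖ + 6 * ε +
        √(ε ^ 2 + 2 * (ε * (r + 1))) * ‖q‖) := by fun_prop
      have h0 := this.tendsto 0
      simp only [mul_zero, add_zero, zero_mul, ne_eq, OfNat.ofNat_ne_zero, not_false_eq_true,
        zero_pow, Real.sqrt_zero] at h0
      exact h0.mono_left nhdsWithin_le_nhds
    exact ge_of_tendsto hlim (eventually_of_mem (Ioo_mem_nhdsGT one_pos) hε)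
  -- Density allows p to be close to u, and then ‖u - p‖ + ‖u' - p‖ ≤ ‖u - u'‖ + 2‖u - p‖.
  refine le_of_forall_pos_le_add fun δ hδ => ?_
  obtain ⟨p, ⟨q, hp⟩, hpu⟩ := Metric.mem_closure_iff.1 (hd u) (δ / 2) (by positivity)
  have h1 := key p q hp
  rw [dist_eq_norm] at hpu
  have h2 : ‖u' - p‖ ≤ ‖u - u'‖ + ‖u - p‖ := by
    rw [norm_sub_rev u u']; exact norm_sub_le_norm_sub_add_norm_sub _ _ _
  linarith

/-- The set of initial values that admit a mild solution. -/
def mildDomain (A : Set (U × U)) : Set U := {u | ∃ v, IsMildSolution A u v}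

lemma isMildSolution_semigroup {u : U} (hu : u ∈ mildDomain A) :
    IsMildSolution A u (fun t => semigroup A t u) := by
  have hu' : ∃ v, IsMildSolution A u v := hu
  simp only [semigroup, dif_pos hu']
  exact hu'.choose_spec

lemma semigroup_of_notMem {u : U} (hu : u ∉ mildDomain A) (t : ℝ) : semigroup A t u = 0 :=
  dif_neg hu

/-- An approximate solution for a nearby v' at tolerance ε/2 serves v at tolerance ε. -/
lemma IsMildSolution.of_uniform_limit {u : U} {v : ℝ → U}
    (h : ∀ ε : ℝ, 0 < ε → ∃ u' v', IsMildSolution A u' v' ∧ ∀ r, 0 ≤ r → ‖v r - v' r‖ ≤ ε)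
    (h0 : v 0 = u) : IsMildSolution A u v := by
  intro S hS
  refine ⟨?_, h0, fun ε hε => ?_⟩
  · refine continuousOn_of_uniform_approx_of_continuousOn fun w hw => ?_
    obtain ⟨ε, hε, hεw⟩ := Metric.mem_uniformity_dist.1 hw
    obtain ⟨u', v', hv', hc⟩ := h (ε / 2) (by positivity)
    refine ⟨v', (hv' S hS).1, fun r hr => hεw ?_⟩
    rw [dist_eq_norm]
    linarith [hc r hr.1]
  · obtain ⟨u', v', hv', hc⟩ := h (ε / 2) (by positivity)
    obtain ⟨N, t, z, f, ha, hz0, hz⟩ := (hv' S hS).2.2 (ε / 2) (by positivity)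
    have hle : ε / 2 < ε := by linarith
    refine ⟨N, t, z, f, ⟨ha.start, ha.step_pos, fun i hi => (ha.step_lt i hi).trans hle,
      ha.le_end, ha.end_lt.trans hle, ha.error_lt.trans hle, ha.euler⟩, ?_, ?_⟩
    · linarith [hc 0 le_rfl, norm_sub_le_norm_sub_add_norm_sub (v 0) (v' 0) (z 0)]
    · intro i hi s hs
      have hpos : ∀ k ≤ N, 0 ≤ t k := by
        intro k
        induction k with
        | zero => intro _; exact ha.start.ge
        | succ k ih => intro hk; exact (ih (by omega)).trans (ha.step_pos k hk).le
      linarith [hc s ((hpos i hi.le).trans hs.1.le), hz i hi s hs,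
        norm_sub_le_norm_sub_add_norm_sub (v s) (v' s) (z (i + 1))]

/-- By contractivity, solutions with convergent initial values are Cauchy uniformly in time. -/
lemma isClosed_mildDomain [CompleteSpace U] (hA : IsAccretive A) (hd : IsDenselyDefined A) :
    IsClosed (mildDomain A) := by
  refine IsSeqClosed.isClosed fun x u hx hu => ?_
  have hcon : ∀ r, 0 ≤ r → ∀ m n, ‖semigroup A r (x m) - semigroup A r (x n)‖ ≤ ‖x m - x n‖ :=
    fun r hr m n => (isMildSolution_semigroup (hx m)).norm_sub_le hA hd
      (isMildSolution_semigroup (hx n)) hr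
  have hlim : ∀ r, 0 ≤ r → ∃ w, Tendsto (fun n => semigroup A r (x n)) atTop (𝓝 w) := by
    intro r hr
    refine cauchySeq_tendsto_of_complete ?_
    have hc := hu.cauchySeq
    rw [Metric.cauchySeq_iff] at hc ⊢
    intro ε hε
    obtain ⟨N, hN⟩ := hc ε hε
    refine ⟨N, fun m hm n hn => ?_⟩
    have := hN m hm n hn
    rw [dist_eq_norm] at this ⊢
    exact (hcon r hr m n).trans_lt this
  choose! v hv using hlim
  refine ⟨v, IsMildSolution.of_uniform_limit (fun ε hε => ?_) ?_⟩
  · obtain ⟨n, hn⟩ := ((Metric.tendsto_nhds.1 hu) ε hε).exists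
    refine ⟨x n, _, isMildSolution_semigroup (hx n), fun r hr => ?_⟩
    have h1 : Tendsto (fun m => ‖semigroup A r (x m) - semigroup A r (x n)‖) atTop
        (𝓝 ‖v r - semigroup A r (x n)‖) := ((hv r hr).sub_const _).norm
    have h2 : Tendsto (fun m => ‖x m - x n‖) atTop (𝓝 ‖u - x n‖) := (hu.sub_const _).norm
    have h3 := le_of_tendsto_of_tendsto' h1 h2 (fun m => hcon r hr m n)
    rw [dist_comm, dist_eq_norm] at hn
    linarith
  · refine tendsto_nhds_unique (hv 0 le_rfl) ?_
    refine hu.congr fun n => ?_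
    exact ((isMildSolution_semigroup (hx n)) 1 one_pos).2.1.symm

/-- The semigroup, extended to negative times by its value at time `0`. -/
def flow (A : Set (U × U)) (t : ℝ) (u : U) : U := semigroup A (max t 0) u

lemma flow_of_nonneg {t : ℝ} (ht : 0 ≤ t) (u : U) : flow A t u = semigroup A t u := by
  rw [flow, max_eq_left ht]

/-- Continuity in time at fixed u combines with a Lipschitz bound in u that is uniform in time. -/
lemma continuousOn_flow (hA : IsAccretive A) (hd : IsDenselyDefined A) :
    ContinuousOn (fun p : ℝ × U => flow A p.1 p.2) (univ ×ˢ mildDomain A) := by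
  rintro ⟨t, u⟩ ⟨-, hu⟩
  rw [ContinuousWithinAt, tendsto_iff_norm_sub_tendsto_zero]
  have hcont : Continuous fun s => flow A s u := by
    have hon : ContinuousOn (fun s => semigroup A s u) (Ici 0) := by
      intro s hs
      have h1 := (isMildSolution_semigroup hu (s + 1) (by linarith [mem_Ici.1 hs])).1 s
        ⟨hs, by linarith⟩
      refine h1.mono_of_mem_nhdsWithin ?_
      rw [← Ici_inter_Iic]
      exact inter_mem_nhdsWithin _ (Iic_mem_nhds (by linarith))
    exact hon.comp_continuous (by fun_prop : Continuous fun s : ℝ => max s 0)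
      (fun s => mem_Ici.2 (le_max_right _ _))
  have h1 : Tendsto (fun p : ℝ × U => ‖p.2 - u‖ + ‖flow A p.1 u - flow A t u‖)
      (𝓝[univ ×ˢ mildDomain A] (t, u)) (𝓝 0) := by
    have hc : Continuous fun p : ℝ × U => ‖p.2 - u‖ + ‖flow A p.1 u - flow A t u‖ := by fun_prop
    have := hc.tendsto (t, u)
    simp only [sub_self, norm_zero, add_zero] at this
    exact this.mono_left nhdsWithin_le_nhds
  refine squeeze_zero' (Eventually.of_forall fun _ => norm_nonneg _) ?_ h1
  filter_upwards [self_mem_nhdsWithin] with p hp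
  refine (norm_sub_le_norm_sub_add_norm_sub _ (flow A p.1 u) _).trans ?_
  gcongr
  exact (isMildSolution_semigroup hp.2).norm_sub_le hA hd (isMildSolution_semigroup hu)
    (le_max_right _ _)

/-- Continuous on a closed set and 0 off it: no existence theorem for mild solutions is required. -/
lemma measurable_flow [CompleteSpace U] [SecondCountableTopology U] [MeasurableSpace U]
    [BorelSpace U] (hA : IsAccretive A) (hd : IsDenselyDefined A) :
    Measurable fun p : ℝ × U => flow A p.1 p.2 := by
  classical
  have hclosed : IsClosed ((univ : Set ℝ) ×ˢ mildDomain A) :=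
    isClosed_univ.prod (isClosed_mildDomain hA hd)
  have h := (continuousOn_flow hA hd).measurable_piecewise
    (continuousOn_const (c := (0 : U))) hclosed.measurableSet
  convert h using 1
  ext p
  by_cases hp : p.2 ∈ mildDomain A
  · have hp' : p ∈ (univ : Set ℝ) ×ˢ mildDomain A := ⟨mem_univ _, hp⟩
    rw [piecewise_eq_of_mem _ _ _ hp']
  · have hp' : p ∉ (univ : Set ℝ) ×ˢ mildDomain A := fun h => hp h.2
    rw [piecewise_eq_of_notMem _ _ _ hp']
    exact semigroup_of_notMem hp _

end MildSolutions

/-! ### Criteria for independence. -/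

section Independence

variable {Ω : Type*} [MeasurableSpace Ω] {μ : Measure Ω}

/-- The past and the future of an independent sequence are independent. -/
lemma iIndepFun_indepFun_shift {E α : Type*} [MeasurableSpace E] [MeasurableSpace α]
    {f : ℕ → Ω → E} (hf : ∀ i, Measurable (f i)) (hi : iIndepFun f μ) (k : ℕ) {F : Ω → α}
    (hF : Measurable[⨆ i ∈ Iio k, MeasurableSpace.comap (f i) inferInstance] F) :
    IndepFun F (fun ω m => f (k + m) ω) μ := by
  rw [IndepFun_iff_Indep]
  have h := indep_iSup_of_disjoint (fun i => (hf i).comap_le)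
    ((iIndepFun_iff_iIndep _ _ _).1 hi) (S := Iio k) (T := Ici k)
    (Iio_disjoint_Ici le_rfl)
  refine indep_of_indep_of_le_left (indep_of_indep_of_le_right h ?_) hF.comap_le
  refine @Measurable.comap_le _ _ (_) _ _ ?_
  refine @measurable_pi_lambda _ _ _ (_) _ _ fun m => ?_
  exact (comap_measurable (f (k + m))).mono
    (le_iSup₂_of_le (k + m) (mem_Ici.2 (Nat.le_add_right k m)) le_rfl) le_rfl

/-- A sequence is independent if each of its members is independent of all later ones. -/
lemma iIndepFun_of_indepFun_tail {E : Type*} [MeasurableSpace E] [IsProbabilityMeasure μ]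
    {f : ℕ → Ω → E} (h : ∀ n, IndepFun (f n) (fun ω m => f (n + 1 + m) ω) μ) :
    iIndepFun f μ := by
  rw [iIndepFun_iff_measure_inter_preimage_eq_mul]
  intro S
  -- Adding indices from below leaves the rest of the event to the tail after `a`.
  induction S using Finset.induction_on_min with
  | empty => simp
  | insert a s ha ih =>
    intro B hB
    have has : a ∉ s := fun h => lt_irrefl _ (ha a h)
    rw [Finset.prod_insert has, Finset.set_biInter_insert,
      ← ih fun i hi => hB i (Finset.mem_insert_of_mem hi)]
    have e : (⋂ i ∈ s, f i ⁻¹' B i) =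
        (fun ω m => f (a + 1 + m) ω) ⁻¹' (⋂ i ∈ s, {y | y (i - (a + 1)) ∈ B i}) := by
      ext ω
      simp only [mem_iInter, mem_preimage, mem_ofPred_eq]
      refine forall₂_congr fun i hi => ?_
      rw [Nat.add_sub_cancel' (ha i hi)]
    rw [e]
    refine (h a).measure_inter_preimage_eq_mul _ _ (hB a (Finset.mem_insert_self _ _)) ?_
    exact Finset.measurableSet_biInter _ fun i hi =>
      measurable_pi_apply _ (hB i (Finset.mem_insert_of_mem hi))

/-- Pairing two independent sequences of independent random variables. -/
lemma iIndepFun_prodMk {ι E F : Type*} [Countable ι] [MeasurableSpace E] [MeasurableSpace F]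
    {f : ι → Ω → E} {g : ι → Ω → F} (hfm : ∀ i, Measurable (f i)) (hgm : ∀ i, Measurable (g i))
    (hf : iIndepFun f μ) (hg : iIndepFun g μ)
    (hfg : IndepFun (fun ω i => f i ω) (fun ω i => g i ω) μ) :
    iIndepFun (fun i ω => (f i ω, g i ω)) μ := by
  rw [iIndepFun_iff_iIndep]
  set R : Set (Set (E × F)) := image2 (· ×ˢ ·) {s | MeasurableSet s} {t | MeasurableSet t} with hR
  refine iIndepSets.iIndep
    (fun i => ((hfm i).prodMk (hgm i)).comap_le)
    (fun i => {t | ∃ s ∈ R, (fun ω => (f i ω, g i ω)) ⁻¹' s = t})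
    (fun i => isPiSystem_prod.comap _) (fun i => ?_) ?_
  · rw [← generateFrom_prod, MeasurableSpace.comap_generateFrom]
    rfl
  · rw [iIndepSets_iff]
    intro S T hT
    have hT' : ∀ i, ∃ a b, MeasurableSet a ∧ MeasurableSet b ∧
        (i ∈ S → T i = f i ⁻¹' a ∩ g i ⁻¹' b) := by
      intro i
      by_cases hi : i ∈ S
      · obtain ⟨s, ⟨a, ha, b, hb, rfl⟩, hs⟩ := hT i hi
        exact ⟨a, b, ha, hb, fun _ => hs.symm⟩
      · exact ⟨∅, ∅, .empty, .empty, fun h => absurd h hi⟩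
    choose a b ha hb hab using hT'
    have h1 : ∀ i ∈ S, μ (T i) = μ (f i ⁻¹' a i) * μ (g i ⁻¹' b i) := by
      intro i hi
      rw [hab i hi]
      exact (hfg.comp (measurable_pi_apply i) (measurable_pi_apply i)).measure_inter_preimage_eq_mul
        _ _ (ha i) (hb i)
    rw [Finset.prod_congr rfl h1, Finset.prod_mul_distrib,
      ← hf.measure_inter_preimage_eq_mul S (fun i _ => ha i),
      ← hg.measure_inter_preimage_eq_mul S (fun i _ => hb i)]
    have e1 : (⋂ i ∈ S, f i ⁻¹' a i) =
        (fun ω i => f i ω) ⁻¹' (⋂ i ∈ S, {y | y i ∈ a i}) := by ext; simp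
    have e2 : (⋂ i ∈ S, g i ⁻¹' b i) =
        (fun ω i => g i ω) ⁻¹' (⋂ i ∈ S, {y | y i ∈ b i}) := by ext; simp
    have e3 : (⋂ i ∈ S, T i) = (⋂ i ∈ S, f i ⁻¹' a i) ∩ (⋂ i ∈ S, g i ⁻¹' b i) := by
      simp only [← iInter_inter_distrib]
      exact iInter₂_congr hab
    rw [e3, e1, e2]
    exact hfg.measure_inter_preimage_eq_mul _ _
      (Finset.measurableSet_biInter _ fun i _ => measurable_pi_apply i (ha i))
      (Finset.measurableSet_biInter _ fun i _ => measurable_pi_apply i (hb i))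

/-- If `f` is independent of `(g, h)` and `g` of `h`, then `(f, g)` is independent of `h`. -/
lemma indepFun_prodMk_left_of_right {α β γ : Type*} [MeasurableSpace α] [MeasurableSpace β]
    [MeasurableSpace γ] [IsProbabilityMeasure μ] {f : Ω → α} {g : Ω → β} {h : Ω → γ}
    (hf : Measurable f) (hg : Measurable g) (hh : Measurable h)
    (h₁ : IndepFun f (fun ω => (g ω, h ω)) μ) (h₂ : IndepFun g h μ) :
    IndepFun (fun ω => (f ω, g ω)) h μ := by
  have hfg : IndepFun f g μ := h₁.comp measurable_id measurable_fst
  have := Measure.isProbabilityMeasure_map (μ := μ) hf.aemeasurable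
  have := Measure.isProbabilityMeasure_map (μ := μ) hg.aemeasurable
  have := Measure.isProbabilityMeasure_map (μ := μ) hh.aemeasurable
  rw [indepFun_iff_map_prod_eq_prod_map_map (by fun_prop) (by fun_prop)] at h₁ h₂ hfg ⊢
  -- After reassociation the joint law is that of (f, (g, h)), which `h₁` and `h₂` factorize.
  apply MeasurableEquiv.prodAssoc.map_measurableEquiv_injective
  rw [hfg, Measure.prodAssoc_prod, ← h₂, ← h₁, Measure.map_map (by fun_prop) (by fun_prop)]
  rfl

end Independence

/-! ### Regeneration of an i.i.d. sequence at a stopping index. -/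

section Regeneration

variable {E : Type*}

/-- The sequence without its first `k` members. -/
def shift (k : ℕ) (z : ℕ → E) : ℕ → E := fun m => z (k + m)

lemma shift_shift (k l : ℕ) (z : ℕ → E) : shift l (shift k z) = shift (k + l) z := by
  ext m; simp [shift, add_assoc]

/-- The sequence from the random index `N` on. -/
def restart (N : (ℕ → E) → ℕ) (z : ℕ → E) : ℕ → E := shift (N z) z

/-- `N` is determined by the first `N` members of the sequence, the value `0` standing for `∞`. -/
def IsStopping (N : (ℕ → E) → ℕ) : Prop :=
  ∀ k z z', 0 < k → (∀ i < k, z i = z' i) → N z = k → N z' = k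

/-- `G` is determined by the first `N` members of the sequence. -/
def IsStopped {α : Type*} (N : (ℕ → E) → ℕ) (G : (ℕ → E) → α) : Prop :=
  ∀ k z z', 0 < k → (∀ i < k, z i = z' i) → N z = k → G z = G z'

variable [MeasurableSpace E]

lemma measurable_shift (k : ℕ) : Measurable (shift k : (ℕ → E) → ℕ → E) :=
  measurable_pi_lambda _ fun m => measurable_pi_apply (k + m)

lemma measurable_restart {N : (ℕ → E) → ℕ} (hN : Measurable N) : Measurable (restart N) := by
  have h : Measurable (fun p : (ℕ → E) × ℕ => shift p.2 p.1) :=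
    measurable_from_prod_countable_left measurable_shift
  exact h.comp (measurable_id.prodMk hN)

lemma measure_eq_tsum_inter_succ {Ω : Type*} [MeasurableSpace Ω] {μ : Measure Ω} {N : Ω → ℕ}
    (hN : Measurable N) (hpos : ∀ᵐ ω ∂μ, 0 < N ω) {S : Set Ω} (hS : MeasurableSet S) :
    μ S = ∑' k, μ (S ∩ {ω | N ω = k + 1}) := by
  rw [← measure_iUnion]
  · refine measure_congr ?_
    filter_upwards [hpos] with ω hω
    refine propext ⟨fun h => mem_iUnion.2 ⟨N ω - 1, h, ?_⟩, fun h => ?_⟩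
    · simp only [mem_ofPred_eq]; omega
    · obtain ⟨k, hk, -⟩ := mem_iUnion.1 h
      exact hk
  · intro i j hij
    refine disjoint_left.2 fun ω h1 h2 => hij ?_
    have h3 : N ω = i + 1 := h1.2
    have h4 : N ω = j + 1 := h2.2
    omega
  · exact fun k => hS.inter (hN (measurableSet_singleton (k + 1)))

variable {Ω α : Type*} [MeasurableSpace Ω] [MeasurableSpace α] {μ : Measure Ω} {ν : Measure E}
  {N : (ℕ → E) → ℕ} {G : (ℕ → E) → α} {Z : Ω → ℕ → E}

lemma map_shift_eq_infinitePi (hZ : ∀ i, Measurable fun ω => Z ω i)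
    (hi : iIndepFun (fun i ω => Z ω i) μ) {k : ℕ} (hν : ∀ i, k ≤ i → μ.map (fun ω => Z ω i) = ν) :
    μ.map (fun ω => shift k (Z ω)) = Measure.infinitePi fun _ => ν := by
  have h := (hi.precomp (add_right_injective k)).map_fun_eq_infinitePi_map (fun i => hZ _)
  simp only [hν _ (Nat.le_add_right k _)] at h
  exact h

/-- The regeneration property: what follows a stopping index is an i.i.d. sequence, independent of
what precedes it. -/
lemma measure_regeneration (hNm : Measurable N) (hN : IsStopping N) (hGm : Measurable G)
    (hG : IsStopped N G) (hZ : ∀ i, Measurable fun ω => Z ω i)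
    (hi : iIndepFun (fun i ω => Z ω i) μ) (hν : ∀ i, 1 ≤ i → μ.map (fun ω => Z ω i) = ν)
    (hpos : ∀ᵐ ω ∂μ, 0 < N (Z ω)) {B : Set α} (hB : MeasurableSet B) {C : Set (ℕ → E)}
    (hC : MeasurableSet C) :
    μ ((fun ω => G (Z ω)) ⁻¹' B ∩ (fun ω => restart N (Z ω)) ⁻¹' C) =
      μ ((fun ω => G (Z ω)) ⁻¹' B) * Measure.infinitePi (fun _ => ν) C := by
  have hZm : Measurable Z := measurable_pi_lambda _ hZ
  have hGZ : Measurable fun ω => G (Z ω) := hGm.comp hZm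
  have hNZ : Measurable fun ω => N (Z ω) := hNm.comp hZm
  have hRZ : Measurable fun ω => restart N (Z ω) := (measurable_restart hNm).comp hZm
  have hSZ : ∀ k, Measurable fun ω => shift k (Z ω) := fun k => (measurable_shift k).comp hZm
  rw [measure_eq_tsum_inter_succ hNZ hpos
      ((hGZ hB).inter (hRZ hC)),
    measure_eq_tsum_inter_succ hNZ hpos (hGZ hB), ← ENNReal.tsum_mul_right]
  congr 1
  ext k
  -- `F` keeps the first k + 1 members and overwrites the others by `Z ω 0`. It is thus measurable
  -- with respect to the past, and on {N = k + 1} it can replace `Z` in `G` and `N`.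
  set F : Ω → ℕ → E := fun ω i => Z ω (if i < k + 1 then i else 0) with hF
  have hFZ : ∀ ω, ∀ i < k + 1, Z ω i = F ω i := fun ω i hik => by simp only [hF, if_pos hik]
  have hev : (fun ω => G (Z ω)) ⁻¹' B ∩ {ω | N (Z ω) = k + 1} =
      F ⁻¹' {z | G z ∈ B ∧ N z = k + 1} := by
    ext ω
    constructor
    · rintro ⟨h1, h2⟩
      refine ⟨?_, hN _ _ _ k.succ_pos (hFZ ω) h2⟩
      rw [← hG _ _ _ k.succ_pos (hFZ ω) h2]
      exact h1
    · rintro ⟨h1, h2⟩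
      have hFZ' : ∀ i < k + 1, F ω i = Z ω i := fun i hik => (hFZ ω i hik).symm
      refine ⟨?_, hN _ _ _ k.succ_pos hFZ' h2⟩
      rw [mem_preimage, ← hG _ _ _ k.succ_pos hFZ' h2]
      exact h1
  have hind : IndepFun F (fun ω => shift (k + 1) (Z ω)) μ := by
    refine iIndepFun_indepFun_shift hZ hi (k + 1) ?_
    refine @measurable_pi_lambda _ _ _ (_) _ _ fun m => ?_
    refine (comap_measurable (fun ω => Z ω (if m < k + 1 then m else 0))).mono
      (le_iSup₂_of_le (if m < k + 1 then m else 0) ?_ le_rfl) le_rfl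
    rw [mem_Iio]
    split_ifs <;> omega
  have hset : (fun ω => G (Z ω)) ⁻¹' B ∩ (fun ω => restart N (Z ω)) ⁻¹' C ∩
      {ω | N (Z ω) = k + 1} =
      F ⁻¹' {z | G z ∈ B ∧ N z = k + 1} ∩ (fun ω => shift (k + 1) (Z ω)) ⁻¹' C := by
    rw [← hev]
    ext ω
    constructor
    · rintro ⟨⟨h1, h2⟩, h3⟩
      refine ⟨⟨h1, h3⟩, ?_⟩
      rw [mem_preimage, restart, h3] at h2
      exact h2
    · rintro ⟨⟨h1, h3⟩, h2⟩
      refine ⟨⟨h1, ?_⟩, h3⟩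
      rw [mem_preimage, restart, h3]
      exact h2
  have hD : MeasurableSet {z | G z ∈ B ∧ N z = k + 1} :=
    (hGm hB).inter (hNm (measurableSet_singleton (k + 1)))
  rw [hset, hind.measure_inter_preimage_eq_mul _ _ hD hC, ← hev]
  congr 1
  -- The future starts at index k + 1 ≥ 1, so the possibly different law at index 0 plays no role.
  rw [← map_shift_eq_infinitePi (k := k + 1) hZ hi fun i hik => hν i (by omega),
    Measure.map_apply (hSZ _) hC]

variable [IsProbabilityMeasure μ]

lemma map_restart (hNm : Measurable N) (hN : IsStopping N) (hZ : ∀ i, Measurable fun ω => Z ω i)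
    (hi : iIndepFun (fun i ω => Z ω i) μ) (hν : ∀ i, 1 ≤ i → μ.map (fun ω => Z ω i) = ν)
    (hpos : ∀ᵐ ω ∂μ, 0 < N (Z ω)) :
    μ.map (fun ω => restart N (Z ω)) = Measure.infinitePi fun _ => ν := by
  ext C hC
  have h := measure_regeneration hNm hN (G := fun _ => ()) measurable_const
    (fun _ _ _ _ _ _ => rfl) hZ hi hν hpos MeasurableSet.univ hC
  have hRZ : Measurable fun ω => restart N (Z ω) :=
    (measurable_restart hNm).comp (measurable_pi_lambda _ hZ)
  rw [Measure.map_apply hRZ hC]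
  simpa using h

lemma indepFun_restart (hNm : Measurable N) (hN : IsStopping N) (hGm : Measurable G)
    (hG : IsStopped N G) (hZ : ∀ i, Measurable fun ω => Z ω i)
    (hi : iIndepFun (fun i ω => Z ω i) μ) (hν : ∀ i, 1 ≤ i → μ.map (fun ω => Z ω i) = ν)
    (hpos : ∀ᵐ ω ∂μ, 0 < N (Z ω)) :
    IndepFun (fun ω => G (Z ω)) (fun ω => restart N (Z ω)) μ := by
  rw [indepFun_iff_measure_inter_preimage_eq_mul]
  intro B C hB hC
  have hRZ : Measurable fun ω => restart N (Z ω) :=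
    (measurable_restart hNm).comp (measurable_pi_lambda _ hZ)
  rw [measure_regeneration hNm hN hGm hG hZ hi hν hpos hB hC, ← map_restart hNm hN hZ hi hν hpos,
    Measure.map_apply hRZ hC]

variable [IsProbabilityMeasure ν]

lemma iIndepFun_coord_of_map_eq {Y : Ω → ℕ → E} (hY : Measurable Y)
    (hlaw : μ.map Y = Measure.infinitePi fun _ => ν) :
    (∀ i, μ.map (fun ω => Y ω i) = ν) ∧ iIndepFun (fun i ω => Y ω i) μ := by
  have h1 : ∀ i, μ.map (fun ω => Y ω i) = ν := by
    intro i
    have : (fun ω => Y ω i) = (fun z : ℕ → E => z i) ∘ Y := rfl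
    rw [this, ← Measure.map_map (measurable_pi_apply i) hY, hlaw, Measure.infinitePi_map_eval]
  refine ⟨h1, ?_⟩
  have hYi : ∀ i, Measurable fun ω => Y ω i := fun i => (measurable_pi_apply i).comp hY
  rw [iIndepFun_iff_map_fun_eq_infinitePi_map hYi]
  simp only [h1]
  exact hlaw

/-- The first restart discards the exceptional index 0; from then on the product law reproduces
itself. -/
lemma map_iterate_restart (hNm : Measurable N) (hN : IsStopping N)
    (hZ : ∀ i, Measurable fun ω => Z ω i) (hi : iIndepFun (fun i ω => Z ω i) μ)
    (hν : ∀ i, 1 ≤ i → μ.map (fun ω => Z ω i) = ν)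
    (hpos : ∀ᵐ ω ∂μ, ∀ n, 0 < N ((restart N)^[n] (Z ω))) (n : ℕ) :
    μ.map (fun ω => (restart N)^[n + 1] (Z ω)) = Measure.infinitePi fun _ => ν := by
  have hm : ∀ n, Measurable fun ω => (restart N)^[n] (Z ω) := fun n =>
    ((measurable_restart hNm).iterate n).comp (measurable_pi_lambda _ hZ)
  induction n with
  | zero => exact map_restart hNm hN hZ hi hν (hpos.mono fun ω h => h 0)
  | succ n ih =>
    obtain ⟨h1, h2⟩ := iIndepFun_coord_of_map_eq (hm (n + 1)) ih
    simp only [Function.iterate_succ_apply' _ (n + 1)]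
    exact map_restart hNm hN (fun i => (measurable_pi_apply i).comp (hm (n + 1))) h2
      (fun i _ => h1 i) (hpos.mono fun ω h => h (n + 1))

/-- The functionals of the successive cycles, from the second one on, are independent. -/
lemma iIndepFun_cycles (hNm : Measurable N) (hN : IsStopping N) (hGm : Measurable G)
    (hG : IsStopped N G) (hZ : ∀ i, Measurable fun ω => Z ω i)
    (hi : iIndepFun (fun i ω => Z ω i) μ) (hν : ∀ i, 1 ≤ i → μ.map (fun ω => Z ω i) = ν)
    (hpos : ∀ᵐ ω ∂μ, ∀ n, 0 < N ((restart N)^[n] (Z ω))) :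
    iIndepFun (fun n ω => G ((restart N)^[n + 1] (Z ω))) μ := by
  have hm : ∀ n, Measurable fun ω => (restart N)^[n] (Z ω) := fun n =>
    ((measurable_restart hNm).iterate n).comp (measurable_pi_lambda _ hZ)
  refine iIndepFun_of_indepFun_tail fun n => ?_
  obtain ⟨h1, h2⟩ := iIndepFun_coord_of_map_eq (hm (n + 1))
    (map_iterate_restart hNm hN hZ hi hν hpos n)
  have h := indepFun_restart (Z := fun ω => (restart N)^[n + 1] (Z ω)) hNm hN hGm hG
    (fun i => (measurable_pi_apply i).comp (hm (n + 1))) h2 (fun i _ => h1 i)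
    (hpos.mono fun ω h => h (n + 1))
  -- All later cycles are one measurable function of the next restarted sequence.
  have hψ : Measurable fun (y : ℕ → E) (m : ℕ) => G ((restart N)^[m] y) :=
    measurable_pi_lambda _ fun m => hGm.comp ((measurable_restart hNm).iterate m)
  have e : (fun ω m => G ((restart N)^[n + 1 + m + 1] (Z ω))) =
      (fun (y : ℕ → E) (m : ℕ) => G ((restart N)^[m] y)) ∘
        fun ω => restart N ((restart N)^[n + 1] (Z ω)) := by
    ext ω m
    simp only [Function.comp_apply]
    rw [← Function.iterate_succ_apply' (restart N), ← Function.iterate_add_apply]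
    congr 2
    omega
  rw [e]
  exact h.comp measurable_id hψ

end Regeneration

/-! ### The chain as a function of its inputs, its extinctions and cycles. -/

section Chain

variable {V : Type*} [NormedAddCommGroup V] [NormedSpace ℝ V] {A : Set (V × V)}

/-- The sequence generated by the inputs `z m = (jump, waiting time)`. -/
def chain (A : Set (V × V)) (z : ℕ → V × ℝ) : ℕ → V
  | 0 => (z 0).1
  | m + 1 => flow A (z m).2 (chain A z m) + (z (m + 1)).1

/-- The chain has become extinct at the end of the `m`-th waiting time. -/
def IsExtinct (A : Set (V × V)) (z : ℕ → V × ℝ) (m : ℕ) : Prop :=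
  flow A (z m).2 (chain A z m) = 0

/-- The number of waiting times up to the first extinction, or `0` if there is none. -/
def firstExtinction (A : Set (V × V)) (z : ℕ → V × ℝ) : ℕ :=
  sInf {k | ∃ m, k = m + 1 ∧ IsExtinct A z m}

lemma chain_congr {z z' : ℕ → V × ℝ} {m : ℕ} (h : ∀ i ≤ m, z i = z' i) :
    chain A z m = chain A z' m := by
  induction m with
  | zero => simp only [chain, h 0 le_rfl]
  | succ m ih =>
    simp only [chain, h (m + 1) le_rfl, h m (Nat.le_succ m), ih fun i hi => h i (by omega)]

lemma isExtinct_congr {z z' : ℕ → V × ℝ} {m : ℕ} (h : ∀ i ≤ m, z i = z' i) :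
    IsExtinct A z m ↔ IsExtinct A z' m := by
  rw [IsExtinct, IsExtinct, chain_congr h, h m le_rfl]

lemma firstExtinction_pos_iff {z : ℕ → V × ℝ} :
    0 < firstExtinction A z ↔ ∃ m, IsExtinct A z m := by
  constructor
  · intro h
    obtain ⟨m, -, hm⟩ := Nat.sInf_mem (Nat.nonempty_of_pos_sInf h)
    exact ⟨m, hm⟩
  · rintro ⟨m, hm⟩
    obtain ⟨l, hl, -⟩ := Nat.sInf_mem (s := {k | ∃ m, k = m + 1 ∧ IsExtinct A z m}) ⟨_, m, rfl, hm⟩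
    rw [firstExtinction, hl]
    exact l.succ_pos

lemma firstExtinction_eq_succ_iff {z : ℕ → V × ℝ} {k : ℕ} :
    firstExtinction A z = k + 1 ↔ IsExtinct A z k ∧ ∀ m < k, ¬ IsExtinct A z m := by
  constructor
  · intro h
    have hpos : 0 < firstExtinction A z := by omega
    obtain ⟨m, hm, hm'⟩ := Nat.sInf_mem (Nat.nonempty_of_pos_sInf hpos)
    have hmk : m = k := by
      have : firstExtinction A z = m + 1 := hm
      omega
    refine ⟨hmk ▸ hm', fun l hl hl' => ?_⟩
    have : firstExtinction A z ≤ l + 1 := Nat.sInf_le ⟨l, rfl, hl'⟩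
    omega
  · rintro ⟨h1, h2⟩
    refine IsLeast.csInf_eq ⟨⟨k, rfl, h1⟩, ?_⟩
    rintro _ ⟨m, rfl, hm⟩
    by_contra hlt
    exact h2 m (by omega) hm

/-- Extinction at index m involves only the inputs 0, …, m, and it is counted as m + 1. -/
lemma isStopping_firstExtinction : IsStopping (firstExtinction A) := by
  intro k z z' hk h hz
  obtain ⟨k, rfl⟩ := Nat.exists_eq_succ_of_ne_zero hk.ne'
  rw [Nat.succ_eq_add_one, firstExtinction_eq_succ_iff] at hz ⊢
  refine ⟨(isExtinct_congr fun i hi => h i (by omega)).1 hz.1, fun m hm => ?_⟩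
  rw [← isExtinct_congr fun i hi => h i (by omega)]
  exact hz.2 m hm

/-- The source of regeneration: after extinction the new state is the bare jump, just as at index 0.
-/
lemma chain_shift {z : ℕ → V × ℝ} {k : ℕ} (h : IsExtinct A z k) (m : ℕ) :
    chain A z (k + 1 + m) = chain A (shift (k + 1) z) m := by
  induction m with
  | zero =>
    rw [IsExtinct] at h
    simp [chain, shift, h]
  | succ m ih => rw [← add_assoc, chain, ih, chain]; rfl

/-- The index at which the `n`-th cycle starts. -/
def cycleStart (A : Set (V × V)) (z : ℕ → V × ℝ) : ℕ → ℕ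
  | 0 => 0
  | n + 1 => cycleStart A z n + firstExtinction A (shift (cycleStart A z n) z)

lemma iterate_restart_eq_shift (z : ℕ → V × ℝ) (n : ℕ) :
    (restart (firstExtinction A))^[n] z = shift (cycleStart A z n) z := by
  induction n with
  | zero => ext m <;> simp [cycleStart, shift]
  | succ n ih => rw [Function.iterate_succ_apply', ih, restart, shift_shift]; rfl

lemma chain_cycleStart_add {z : ℕ → V × ℝ}
    (hz : ∀ n, 0 < firstExtinction A (shift (cycleStart A z n) z)) (n m : ℕ) :
    chain A z (cycleStart A z n + m) = chain A (shift (cycleStart A z n) z) m := by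
  induction n generalizing m with
  | zero =>
    have : shift (cycleStart A z 0) z = z := by ext m <;> simp [cycleStart, shift]
    rw [this, cycleStart, zero_add]
  | succ n ih =>
    obtain ⟨k, hk⟩ := Nat.exists_eq_succ_of_ne_zero (hz n).ne'
    have hext := (firstExtinction_eq_succ_iff.1 hk).1
    have h := chain_shift hext m
    rw [← ih, shift_shift] at h
    rw [cycleStart, hk, Nat.succ_eq_add_one, add_assoc, h]

lemma isExtinct_cycleStart_add {z : ℕ → V × ℝ}
    (hz : ∀ n, 0 < firstExtinction A (shift (cycleStart A z n) z)) (n m : ℕ) :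
    IsExtinct A z (cycleStart A z n + m) ↔ IsExtinct A (shift (cycleStart A z n) z) m := by
  rw [IsExtinct, chain_cycleStart_add hz]
  rfl

variable {W : Type*} [NormedAddCommGroup W] [NormedSpace ℝ W]

/-- The integral of `Ξ` along the first cycle. -/
def cycleIntegral (A : Set (V × V)) (Ξ : V → W) (z : ℕ → V × ℝ) : W :=
  ∑ m ∈ Finset.range (firstExtinction A z), ∫ s in (0 : ℝ)..(z m).2, Ξ (flow A s (chain A z m))

lemma isStopped_cycleIntegral (Ξ : V → W) : IsStopped (firstExtinction A) (cycleIntegral A Ξ) := by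
  intro k z z' hk h hz
  rw [cycleIntegral, cycleIntegral, hz, isStopping_firstExtinction k z z' hk h hz]
  refine Finset.sum_congr rfl fun m hm => ?_
  have hm := Finset.mem_range.1 hm
  rw [h m hm, chain_congr fun i hi => h i (by omega)]

variable [CompleteSpace V] [SecondCountableTopology V] [MeasurableSpace V] [BorelSpace V]

lemma measurable_chain (hA : IsAccretive A) (hd : IsDenselyDefined A) (m : ℕ) :
    Measurable fun z : ℕ → V × ℝ => chain A z m := by
  induction m with
  | zero => exact measurable_fst.comp (measurable_pi_apply 0)
  | succ m ih =>
    exact ((measurable_flow hA hd).comp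
      ((measurable_snd.comp (measurable_pi_apply m)).prodMk ih)).add
      (measurable_fst.comp (measurable_pi_apply (m + 1)))

lemma measurableSet_isExtinct (hA : IsAccretive A) (hd : IsDenselyDefined A) (m : ℕ) :
    MeasurableSet {z : ℕ → V × ℝ | IsExtinct A z m} :=
  ((measurable_flow hA hd).comp ((measurable_snd.comp (measurable_pi_apply m)).prodMk
    (measurable_chain hA hd m))) (measurableSet_singleton 0)

lemma measurable_firstExtinction (hA : IsAccretive A) (hd : IsDenselyDefined A) :
    Measurable (firstExtinction A : (ℕ → V × ℝ) → ℕ) := by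
  refine measurable_to_countable' fun k => ?_
  cases k with
  | zero =>
    have : firstExtinction A ⁻¹' {0} = ⋂ m, {z : ℕ → V × ℝ | IsExtinct A z m}ᶜ := by
      ext z
      simp only [mem_preimage, mem_singleton_iff, mem_iInter, mem_compl_iff, mem_ofPred_eq,
        ← not_exists, ← firstExtinction_pos_iff (A := A)]
      omega
    rw [this]
    exact .iInter fun m => (measurableSet_isExtinct hA hd m).compl
  | succ k =>
    have : firstExtinction A ⁻¹' {k + 1} = {z : ℕ → V × ℝ | IsExtinct A z k} ∩
        ⋂ m, ⋂ (_ : m < k), {z : ℕ → V × ℝ | IsExtinct A z m}ᶜ := by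
      ext z
      simp [firstExtinction_eq_succ_iff]
    rw [this]
    exact (measurableSet_isExtinct hA hd k).inter
      (.iInter fun m => .iInter fun _ => (measurableSet_isExtinct hA hd m).compl)

lemma measurable_cycleIntegral [SecondCountableTopology W] [MeasurableSpace W] [BorelSpace W]
    (hA : IsAccretive A) (hd : IsDenselyDefined A) {Ξ : V → W} (hΞ : Measurable Ξ) :
    Measurable (cycleIntegral A Ξ) := by
  have hpiece : ∀ m, Measurable fun z : ℕ → V × ℝ =>
      ∫ s in (0 : ℝ)..(z m).2, Ξ (flow A s (chain A z m)) := by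
    intro m
    have hz : Measurable fun p : (ℕ → V × ℝ) × ℝ => (p.1 m).2 :=
      measurable_snd.comp ((measurable_pi_apply m).comp measurable_fst)
    have hf : Measurable fun p : (ℕ → V × ℝ) × ℝ => Ξ (flow A p.2 (chain A p.1 m)) :=
      hΞ.comp ((measurable_flow hA hd).comp
        (measurable_snd.prodMk ((measurable_chain hA hd m).comp measurable_fst)))
    -- Variable endpoints are turned into indicators, so that measurability of parametric integrals
    -- applies. Both orientations occur, since the waiting time has no sign here.
    have key : ∀ S : Set ((ℕ → V × ℝ) × ℝ), MeasurableSet S → Measurable fun z =>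
        ∫ s, S.indicator (fun p => Ξ (flow A p.2 (chain A p.1 m))) (z, s) := fun S hS =>
      (hf.indicator hS).stronglyMeasurable.integral_prod_right'.measurable
    have h1 := key {p | 0 < p.2 ∧ p.2 ≤ (p.1 m).2}
      ((measurableSet_lt measurable_const measurable_snd).inter
        (measurableSet_le measurable_snd hz))
    have h2 := key {p | (p.1 m).2 < p.2 ∧ p.2 ≤ 0}
      ((measurableSet_lt hz measurable_snd).inter
        (measurableSet_le measurable_snd measurable_const))
    convert h1.sub h2 using 1
    ext z
    rw [intervalIntegral, ← integral_indicator measurableSet_Ioc,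
      ← integral_indicator measurableSet_Ioc]
    rfl
  have h : Measurable fun p : (ℕ → V × ℝ) × ℕ =>
      ∑ m ∈ Finset.range p.2, ∫ s in (0 : ℝ)..(p.1 m).2, Ξ (flow A s (chain A p.1 m)) :=
    measurable_from_prod_countable_left fun k =>
      Finset.measurable_sum (Finset.range k) fun m _ => hpiece m
  exact h.comp (measurable_id.prodMk (measurable_firstExtinction hA hd))

end Chain

/-! ### The norms of the subspaces, carried over to `V`. -/

section SubNorm

variable {E V : Type*} [NormedAddCommGroup E] [NormedSpace ℝ E] [NormedAddCommGroup V]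
  [NormedSpace ℝ V] {ι : E →L[ℝ] V}

lemma subNorm_apply (hι : Function.Injective ι) (w : E) : subNorm ι (ι w) = ‖w‖ :=
  hι.extend_apply _ _ _

lemma subNorm_nonneg (ι : E →L[ℝ] V) (v : V) : 0 ≤ subNorm ι v := by
  classical
  rw [subNorm, Function.extend_def]
  split_ifs
  · exact norm_nonneg _
  · exact le_rfl

lemma subNorm_add_le (hι : Function.Injective ι) {v w : V} (hv : v ∈ range ι) (hw : w ∈ range ι) :
    subNorm ι (v + w) ≤ subNorm ι v + subNorm ι w := by
  obtain ⟨v, rfl⟩ := hv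
  obtain ⟨w, rfl⟩ := hw
  rw [← map_add, subNorm_apply hι, subNorm_apply hι, subNorm_apply hι]
  exact norm_add_le _ _

lemma subNorm_pos (hι : Function.Injective ι) {v : V} (hv : v ∈ range ι) (h0 : v ≠ 0) :
    0 < subNorm ι v := by
  obtain ⟨v, rfl⟩ := hv
  rw [subNorm_apply hι, norm_pos_iff]
  rintro rfl
  exact h0 (map_zero _)

lemma add_mem_range {v w : V} (hv : v ∈ range ι) (hw : w ∈ range ι) : v + w ∈ range ι := by
  obtain ⟨v, rfl⟩ := hv
  obtain ⟨w, rfl⟩ := hw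
  exact ⟨v + w, map_add _ _ _⟩

variable [CompleteSpace E] [SecondCountableTopology E] [MeasurableSpace V] [BorelSpace V]

/-- By Lusin–Souslin, a continuous injection of a Polish space is a measurable embedding. -/
lemma measurableSet_range_and_measurable_subNorm (hι : Function.Injective ι) :
    MeasurableSet (range ι) ∧ Measurable (subNorm ι) := by
  let _ : MeasurableSpace E := borel E
  have : BorelSpace E := ⟨rfl⟩
  have he : MeasurableEmbedding ι := ι.continuous.measurableEmbedding hι
  exact ⟨he.measurableSet_range, he.measurable_extend measurable_norm measurable_const⟩

end SubNorm

/-! ### Extinction along paths with negative drift. -/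

section GoodPath

variable {V V₁ V₂ : Type*} [NormedAddCommGroup V] [NormedSpace ℝ V]
  [NormedAddCommGroup V₁] [NormedSpace ℝ V₁] [NormedAddCommGroup V₂] [NormedSpace ℝ V₂]
  {A : Set (V × V)} {ι₁ : V₁ →L[ℝ] V} {ι₂ : V₂ →L[ℝ] V} {κ ρ : ℝ}

/-- Inputs in `V₁ ∩ V₂` with positive waiting times and a drift towards extinction. -/
structure IsGoodPath (ι₁ : V₁ →L[ℝ] V) (ι₂ : V₂ →L[ℝ] V) (κ ρ : ℝ) (z : ℕ → V × ℝ) : Prop where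
  pos : ∀ m, 0 < (z m).2
  mem₁ : ∀ m, (z m).1 ∈ range ι₁
  mem₂ : ∀ m, (z m).1 ∈ range ι₂
  drift : Tendsto (fun n => ∑ m ∈ Finset.range n, (subNorm ι₁ (z (m + 1)).1 ^ ρ - κ * (z m).2))
    atTop atBot

lemma IsGoodPath.shift {z : ℕ → V × ℝ} (h : IsGoodPath ι₁ ι₂ κ ρ z) (k : ℕ) :
    IsGoodPath ι₁ ι₂ κ ρ (shift k z) := by
  refine ⟨fun m => h.pos _, fun m => h.mem₁ _, fun m => h.mem₂ _, ?_⟩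
  set a : ℕ → ℝ := fun m => subNorm ι₁ (z (m + 1)).1 ^ ρ - κ * (z m).2 with ha
  have h1 : Tendsto (fun n => ∑ m ∈ Finset.range (k + n), a m) atTop atBot :=
    h.drift.comp (tendsto_atTop_mono (fun n => Nat.le_add_left n k) tendsto_id)
  have h2 := tendsto_atBot_add_const_right _ (-∑ m ∈ Finset.range k, a m) h1
  refine h2.congr fun n => ?_
  rw [Finset.sum_range_add]
  simp only [ha, AccretiveJump.shift, add_assoc]
  ring

lemma IsGoodPath.chain_mem₁ (hT : SemigroupAssumption A ι₁ ι₂ κ ρ) {z : ℕ → V × ℝ}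
    (h : IsGoodPath ι₁ ι₂ κ ρ z) (m : ℕ) : chain A z m ∈ range ι₁ := by
  induction m with
  | zero => exact h.mem₁ 0
  | succ m ih => exact add_mem_range (hT.invariant₁ _ (le_max_right _ _) _ ih) (h.mem₁ _)

lemma IsGoodPath.chain_mem₂ (hT : SemigroupAssumption A ι₁ ι₂ κ ρ) {z : ℕ → V × ℝ}
    (h : IsGoodPath ι₁ ι₂ κ ρ z) (m : ℕ) : chain A z m ∈ range ι₂ := by
  induction m with
  | zero => exact h.mem₂ 0
  | succ m ih => exact add_mem_range (hT.invariant₂ _ (le_max_right _ _) _ ih) (h.mem₂ _)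

/-- Without extinction the maximum in `decay₁` is never 0, so each step adds at most the drift
increment to ‖·‖_{V₁}^ρ. The sums tend to −∞, while the norms stay nonnegative. -/
lemma IsGoodPath.exists_isExtinct (hT : SemigroupAssumption A ι₁ ι₂ κ ρ) {z : ℕ → V × ℝ}
    (h : IsGoodPath ι₁ ι₂ κ ρ z) : ∃ m, IsExtinct A z m := by
  by_contra! hne
  have hstep : ∀ m, subNorm ι₁ (chain A z (m + 1)) ^ ρ ≤
      subNorm ι₁ (chain A z m) ^ ρ + (subNorm ι₁ (z (m + 1)).1 ^ ρ - κ * (z m).2) := by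
    intro m
    have hpos := (h.pos m).le
    have hmem : flow A (z m).2 (chain A z m) ∈ range ι₁ :=
      hT.invariant₁ _ (le_max_right _ _) _ (h.chain_mem₁ hT m)
    have h1 : subNorm ι₁ (chain A z (m + 1)) ^ ρ ≤
        subNorm ι₁ (flow A (z m).2 (chain A z m)) ^ ρ + subNorm ι₁ (z (m + 1)).1 ^ ρ :=
      (Real.rpow_le_rpow (subNorm_nonneg _ _) (subNorm_add_le hT.inj₁ hmem (h.mem₁ _))
        hT.rho_mem.1.le).trans (Real.rpow_add_le_add_rpow (subNorm_nonneg _ _)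
          (subNorm_nonneg _ _) hT.rho_mem.1.le hT.rho_mem.2.le)
    have h2 := hT.decay₁ (z m).2 hpos _ (h.chain_mem₁ hT m)
    rw [← flow_of_nonneg hpos] at h2
    have h3 : 0 < subNorm ι₁ (flow A (z m).2 (chain A z m)) ^ ρ :=
      Real.rpow_pos_of_pos (subNorm_pos hT.inj₁ hmem (hne m)) _
    rcases le_max_iff.1 h2 with h4 | h4 <;> linarith
  have hsum : ∀ n, subNorm ι₁ (chain A z n) ^ ρ ≤ subNorm ι₁ (chain A z 0) ^ ρ +
      ∑ m ∈ Finset.range n, (subNorm ι₁ (z (m + 1)).1 ^ ρ - κ * (z m).2) := by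
    intro n
    induction n with
    | zero => simp
    | succ n ih => rw [Finset.sum_range_succ]; linarith [hstep n]
  obtain ⟨n, hn⟩ := (h.drift.eventually_lt_atBot (-subNorm ι₁ (chain A z 0) ^ ρ)).exists
  have h1 := hsum n
  have h2 : 0 ≤ subNorm ι₁ (chain A z n) ^ ρ := Real.rpow_nonneg (subNorm_nonneg _ _) _
  linarith

lemma IsGoodPath.firstExtinction_pos (hT : SemigroupAssumption A ι₁ ι₂ κ ρ) {z : ℕ → V × ℝ}
    (h : IsGoodPath ι₁ ι₂ κ ρ z) (k : ℕ) : 0 < firstExtinction A (AccretiveJump.shift k z) :=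
  firstExtinction_pos_iff.2 ((h.shift k).exists_isExtinct hT)

end GoodPath

/-! ### From the generated process to the chain, path by path. -/

section Paths

variable {Ω V V₁ V₂ W : Type*} [NormedAddCommGroup V] [NormedSpace ℝ V]
  [NormedAddCommGroup V₁] [NormedSpace ℝ V₁] [NormedAddCommGroup V₂] [NormedSpace ℝ V₂]
  [NormedAddCommGroup W] {A : Set (V × V)} {ι₁ : V₁ →L[ℝ] V} {ι₂ : V₂ →L[ℝ] V} {κ ρ : ℝ}
  {β : ℕ → Ω → ℝ} {η : ℕ → Ω → V} {x : Ω → V} {ω : Ω}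

/-- The inputs of the chain: each jump is paired with the waiting time that follows it. -/
def inputSeq (β : ℕ → Ω → ℝ) (η : ℕ → Ω → V) (x : Ω → V) (ω : Ω) (m : ℕ) : V × ℝ :=
  (Nat.casesOn m (x ω) fun k => η k ω, β m ω)

lemma genSeq_eq_chain (hβ : ∀ m, 0 < β m ω) (m : ℕ) :
    genSeq A β η x m ω = chain A (inputSeq β η x ω) m := by
  induction m with
  | zero => rfl
  | succ m ih => rw [genSeq, ih, ← flow_of_nonneg (hβ m).le]; rfl

lemma semigroup_genSeq_eq_zero_iff (hβ : ∀ m, 0 < β m ω) (m : ℕ) :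
    semigroup A (β m ω) (genSeq A β η x m ω) = 0 ↔ IsExtinct A (inputSeq β η x ω) m := by
  rw [genSeq_eq_chain hβ, ← flow_of_nonneg (hβ m).le]
  rfl

/-- Extinctions of the whole chain after a cycle start are those of the shifted chain, so the next
one is the first extinction there. -/
lemma extinctionTime_eq_cycleStart (hβ : ∀ m, 0 < β m ω)
    (hz : ∀ k, 0 < firstExtinction A (shift k (inputSeq β η x ω))) (n : ℕ) :
    extinctionTime A β η x n ω = (cycleStart A (inputSeq β η x ω) n : ℕ∞) := by
  induction n with
  | zero => rfl
  | succ n ih =>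
    rw [extinctionTime, ih]
    simp only [semigroup_genSeq_eq_zero_iff hβ]
    set z := inputSeq β η x ω
    obtain ⟨k, hk⟩ := Nat.exists_eq_succ_of_ne_zero (hz (cycleStart A z n)).ne'
    obtain ⟨h1, h2⟩ := firstExtinction_eq_succ_iff.1 hk
    rw [cycleStart, hk]
    refine IsLeast.csInf_eq ⟨⟨cycleStart A z n + k, rfl, ?_, ?_⟩, ?_⟩
    · exact_mod_cast Nat.lt_add_of_pos_right k.succ_pos
    · exact (isExtinct_cycleStart_add (fun n => hz _) n k).2 h1
    · rintro _ ⟨m, rfl, hm, hext⟩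
      have hm' : cycleStart A z n < m + 1 := by exact_mod_cast hm
      obtain ⟨l, rfl⟩ := Nat.exists_eq_add_of_le (Nat.lt_succ_iff.1 hm')
      rw [isExtinct_cycleStart_add (fun n => hz _)] at hext
      have hkl : k ≤ l := by
        by_contra! hlt
        exact h2 l hlt hext
      exact_mod_cast (by omega : cycleStart A z n + k.succ ≤ cycleStart A z n + l + 1)

lemma jumpTime_succ (β : ℕ → Ω → ℝ) (m : ℕ) (ω : Ω) :
    jumpTime β (m + 1) ω = jumpTime β m ω + β m ω := Finset.sum_range_succ _ _

lemma genProcess_eq_flow (hβ : ∀ m, 0 < β m ω) {m : ℕ} {t : ℝ}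
    (ht : t ∈ Ico (jumpTime β m ω) (jumpTime β (m + 1) ω)) :
    genProcess A β η x t ω = flow A (t - jumpTime β m ω) (chain A (inputSeq β η x ω) m) := by
  have hmono : StrictMono fun m => jumpTime β m ω :=
    strictMono_nat_of_lt_succ fun m => by rw [jumpTime_succ]; linarith [hβ m]
  rw [genProcess, tsum_eq_single m, indicator_of_mem ht, genSeq_eq_chain hβ, flow]
  intro k hk
  refine indicator_of_notMem (fun htk => ?_) _
  rcases lt_or_gt_of_ne hk with h | h
  · have : jumpTime β (k + 1) ω ≤ jumpTime β m ω := hmono.monotone h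
    linarith [htk.2, ht.1]
  · have : jumpTime β (m + 1) ω ≤ jumpTime β k ω := hmono.monotone h
    linarith [htk.1, ht.2]

lemma extinctionInstant_zero : extinctionInstant A β η x 0 ω = 0 := by
  simp [extinctionInstant, extinctionTime, jumpTime]

section Integrals

variable [CompleteSpace V] [SecondCountableTopology V] [MeasurableSpace V] [BorelSpace V]
  [SecondCountableTopology W] [MeasurableSpace W] [BorelSpace W] {Ξ : V → W}

/-- The integrand is bounded, since the flow does not increase the `V₂`-norm and `Ξ` grows at most
linearly in it. -/
lemma intervalIntegrable_flow (hA : IsAccretive A) (hd : IsDenselyDefined A)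
    (hT : SemigroupAssumption A ι₁ ι₂ κ ρ) (hΞ : IsSubLinear ι₂ Ξ) {u : V} (hu : u ∈ range ι₂)
    (a b : ℝ) : IntervalIntegrable (fun s => Ξ (flow A s u)) volume a b := by
  obtain ⟨c₁, c₂, hc₁, -, hc⟩ := hΞ.bound
  have hm : Measurable fun s => Ξ (flow A s u) :=
    hΞ.measurable.comp ((measurable_flow hA hd).comp (measurable_id.prodMk measurable_const))
  rw [intervalIntegrable_iff]
  refine Measure.integrableOn_of_bounded (M := c₁ * subNorm ι₂ u + c₂) (by simp [uIoc])
    hm.aestronglyMeasurable (Eventually.of_forall fun s => ?_)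
  refine (hc _ (hT.invariant₂ _ (le_max_right _ _) _ hu)).trans ?_
  gcongr
  exact hT.contract₂ _ (le_max_right _ _) _ hu

variable [NormedSpace ℝ W]

lemma genProcess_integral_step (hA : IsAccretive A) (hd : IsDenselyDefined A)
    (hT : SemigroupAssumption A ι₁ ι₂ κ ρ) (hΞ : IsSubLinear ι₂ Ξ)
    (hz : IsGoodPath ι₁ ι₂ κ ρ (inputSeq β η x ω)) (m : ℕ) :
    IntervalIntegrable (fun τ => Ξ (genProcess A β η x τ ω)) volume
      (jumpTime β m ω) (jumpTime β (m + 1) ω) ∧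
    ∫ τ in (jumpTime β m ω)..(jumpTime β (m + 1) ω), Ξ (genProcess A β η x τ ω) =
      ∫ s in (0 : ℝ)..β m ω, Ξ (flow A s (chain A (inputSeq β η x ω) m)) := by
  have hβ : ∀ m, 0 < β m ω := hz.pos
  set g : ℝ → W := fun s => Ξ (flow A s (chain A (inputSeq β η x ω) m)) with hg
  have hlt : jumpTime β m ω ≤ jumpTime β (m + 1) ω := by
    rw [jumpTime_succ]; linarith [hβ m]
  -- The open interval suffices: at the right endpoint the process has already jumped.
  have heq : EqOn (fun τ => g (τ - jumpTime β m ω)) (fun τ => Ξ (genProcess A β η x τ ω))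
      (Ioo (jumpTime β m ω) (jumpTime β (m + 1) ω)) := fun τ hτ => by
    simp only [hg, genProcess_eq_flow hβ (Ioo_subset_Ico_self hτ)]
  constructor
  · have h1 := (intervalIntegrable_flow hA hd hT hΞ (hz.chain_mem₂ hT m) 0 (β m ω)).comp_sub_right
      (jumpTime β m ω)
    rw [zero_add, add_comm, ← jumpTime_succ] at h1
    refine h1.congr_uIoo ?_
    rw [uIoo_of_le hlt]
    exact heq
  · have h2 := intervalIntegral.integral_comp_sub_right (a := jumpTime β m ω)
      (b := jumpTime β (m + 1) ω) g (jumpTime β m ω)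
    rw [sub_self, jumpTime_succ, add_sub_cancel_left, ← jumpTime_succ] at h2
    rw [← h2, intervalIntegral.integral_of_le hlt, intervalIntegral.integral_of_le hlt,
      integral_Ioc_eq_integral_Ioo, integral_Ioc_eq_integral_Ioo]
    exact (setIntegral_congr_fun measurableSet_Ioo heq).symm

/-- On a good path, the integral over the `n`-th cycle is the cycle integral of the restarted
inputs. -/
lemma genProcess_cycle (hA : IsAccretive A) (hd : IsDenselyDefined A)
    (hT : SemigroupAssumption A ι₁ ι₂ κ ρ) (hΞ : IsSubLinear ι₂ Ξ)
    (hz : IsGoodPath ι₁ ι₂ κ ρ (inputSeq β η x ω)) (n : ℕ) :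
    extinctionTime A β η x n ω ≠ ⊤ ∧
    IntervalIntegrable (fun τ => Ξ (genProcess A β η x τ ω)) volume
      (extinctionInstant A β η x n ω) (extinctionInstant A β η x (n + 1) ω) ∧
    ∫ τ in (extinctionInstant A β η x n ω)..(extinctionInstant A β η x (n + 1) ω),
      Ξ (genProcess A β η x τ ω) =
      cycleIntegral A Ξ ((restart (firstExtinction A))^[n] (inputSeq β η x ω)) := by
  have hβ : ∀ m, 0 < β m ω := hz.pos
  have hpos := hz.firstExtinction_pos hT
  have hstep := genProcess_integral_step hA hd hT hΞ hz
  simp only [extinctionInstant, extinctionTime_eq_cycleStart hβ hpos, ENat.toNat_natCast]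
  rw [iterate_restart_eq_shift]
  set z := inputSeq β η x ω with hzdef
  set a : ℕ → ℝ := fun l => jumpTime β (cycleStart A z n + l) ω with ha
  have h0 : jumpTime β (cycleStart A z n) ω = a 0 := rfl
  have h1 : jumpTime β (cycleStart A z (n + 1)) ω =
      a (firstExtinction A (shift (cycleStart A z n) z)) := rfl
  rw [h0, h1]
  have hint : ∀ l, IntervalIntegrable (fun τ => Ξ (genProcess A β η x τ ω)) volume
      (a l) (a (l + 1)) := fun l => (hstep _).1
  refine ⟨ENat.natCast_ne_top _, .trans_iterate fun l _ => hint l, ?_⟩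
  rw [← intervalIntegral.sum_integral_adjacent_intervals fun l _ => hint l, cycleIntegral]
  refine Finset.sum_congr rfl fun l _ => ?_
  rw [← chain_cycleStart_add (fun n => hpos _)]
  exact (hstep _).2

end Integrals

end Paths

/-! ### The law of the inputs and the almost sure drift. -/

section Noise

variable {Ω V V₁ V₂ : Type*} [MeasurableSpace Ω] {μ : Measure Ω}
  [NormedAddCommGroup V] [NormedSpace ℝ V] [MeasurableSpace V]
  [NormedAddCommGroup V₁] [NormedSpace ℝ V₁] [NormedAddCommGroup V₂] [NormedSpace ℝ V₂]
  {ι₁ : V₁ →L[ℝ] V} {ι₂ : V₂ →L[ℝ] V} {κ ρ : ℝ}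
  {β : ℕ → Ω → ℝ} {η : ℕ → Ω → V} {x : Ω → V}

lemma NoiseAssumption.measurable_inputSeq (hN : NoiseAssumption μ ι₁ ι₂ κ ρ β η)
    (hx : Measurable x) (m : ℕ) : Measurable fun ω => inputSeq β η x ω m := by
  cases m with
  | zero => exact hx.prodMk (hN.measurable_beta 0)
  | succ m => exact (hN.measurable_eta m).prodMk (hN.measurable_beta (m + 1))

variable [IsProbabilityMeasure μ]

lemma integrable_of_integrable_rpow {f : Ω → ℝ} (hf : AEStronglyMeasurable f μ)
    (h0 : ∀ ω, 0 ≤ f ω) {p : ℝ} (hp : 1 ≤ p) (h : Integrable (fun ω => f ω ^ p) μ) :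
    Integrable f μ := by
  refine ((integrable_const (1 : ℝ)).add h).mono' hf (Eventually.of_forall fun ω => ?_)
  rw [Real.norm_of_nonneg (h0 ω)]
  have hnn : 0 ≤ f ω ^ p := Real.rpow_nonneg (h0 ω) p
  simp only [Pi.add_apply]
  rcases le_total (f ω) 1 with h1 | h1
  · linarith
  · linarith [Real.self_le_rpow_of_one_le h1 hp]

/-- By the law of large numbers, the noise drives the `V₁`-norm to extinction. -/
lemma NoiseAssumption.tendsto_drift (hN : NoiseAssumption μ ι₁ ι₂ κ ρ β η)
    (hm : Measurable (subNorm ι₁)) :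
    ∀ᵐ ω ∂μ, Tendsto (fun n => ∑ m ∈ Finset.range n, (subNorm ι₁ (η m ω) ^ ρ - κ * β m ω))
      atTop atBot := by
  obtain ⟨ε, hε, hmom⟩ := hN.moments
  have hg : Measurable fun v => subNorm ι₁ v ^ ρ := hm.pow_const ρ
  have hiβ : Integrable (β 0) μ := integrable_of_integrable_rpow
    (hN.measurable_beta 0).aestronglyMeasurable (fun ω => (hN.beta_pos 0 ω).le)
    (by linarith : 1 ≤ 11 + ε) (hmom 0).2
  have hiη : Integrable (fun ω => subNorm ι₁ (η 0 ω) ^ ρ) μ := by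
    refine integrable_of_integrable_rpow (p := 11 + ε)
      (hg.comp (hN.measurable_eta 0)).aestronglyMeasurable
      (fun ω => Real.rpow_nonneg (subNorm_nonneg _ _) _) (by linarith) ?_
    refine (hmom 0).1.congr (Eventually.of_forall fun ω => ?_)
    exact Real.rpow_mul (subNorm_nonneg _ _) _ _
  have h1 := strong_law_ae_real β hiβ (fun i j hij => hN.indep_beta.indepFun hij) hN.ident_beta
  have h2 := strong_law_ae_real (fun m ω => subNorm ι₁ (η m ω) ^ ρ) hiη
    (fun i j hij => (hN.indep_eta.indepFun hij).comp hg hg) (fun i => (hN.ident_eta i).comp hg)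
  filter_upwards [h1, h2] with ω hω1 hω2
  have h3 := (hω2.sub (hω1.const_mul κ))
  -- The averages converge to a negative limit, so n times the average tends to −∞.
  have h4 := (tendsto_natCast_atTop_atTop (R := ℝ)).atTop_mul_neg
    (by linarith [hN.drift 0] : (∫ ω, subNorm ι₁ (η 0 ω) ^ ρ ∂μ) - κ * ∫ ω, β 0 ω ∂μ < 0) h3
  refine h4.congr' ?_
  filter_upwards [eventually_ne_atTop 0] with n hn
  have hn' : (n : ℝ) ≠ 0 := Nat.cast_ne_zero.2 hn
  rw [Finset.sum_sub_distrib, ← Finset.mul_sum]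
  field_simp

lemma NoiseAssumption.isGoodPath (hN : NoiseAssumption μ ι₁ ι₂ κ ρ β η)
    (hm : Measurable (subNorm ι₁)) (hx₁ : ∀ᵐ ω ∂μ, x ω ∈ range ι₁)
    (hx₂ : ∀ᵐ ω ∂μ, x ω ∈ range ι₂) :
    ∀ᵐ ω ∂μ, IsGoodPath ι₁ ι₂ κ ρ (inputSeq β η x ω) := by
  filter_upwards [hN.tendsto_drift hm, hx₁, hx₂, ae_all_iff.2 hN.eta_mem₁,
    ae_all_iff.2 hN.eta_mem₂] with ω h1 h2 h3 h4 h5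
  -- `h1` fits as it stands because the jump of input m + 1 is `η m`.
  refine ⟨fun m => hN.beta_pos m ω, fun m => ?_, fun m => ?_, h1⟩
  · cases m with
    | zero => exact h2
    | succ m => exact h4 m
  · cases m with
    | zero => exact h3
    | succ m => exact h5 m

/-- The jumps x, η_1, η_2, … are independent by the tail criterion; they are jointly independent of
the waiting times, with which they are then paired. -/
lemma NoiseAssumption.iIndepFun_inputSeq (hN : NoiseAssumption μ ι₁ ι₂ κ ρ β η)
    (hx : Measurable x) (hind : IndepOfNoise μ β η x) :
    iIndepFun (fun m ω => inputSeq β η x ω m) μ := by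
  have hηm : Measurable fun ω m => η m ω := measurable_pi_lambda _ hN.measurable_eta
  have hβm : Measurable fun ω m => β m ω := measurable_pi_lambda _ hN.measurable_beta
  have hwm : ∀ m, Measurable fun ω => (inputSeq β η x ω m).1 := fun m =>
    measurable_fst.comp (hN.measurable_inputSeq hx m)
  have hxη : IndepFun x (fun ω m => η m ω) μ := hind.comp measurable_id measurable_snd
  have hw : iIndepFun (fun m ω => (inputSeq β η x ω m).1) μ := by
    refine iIndepFun_of_indepFun_tail fun n => ?_
    cases n with
    | zero =>
      have e : (fun ω m => (inputSeq β η x ω (0 + 1 + m)).1) = fun ω m => η m ω := by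
        ext ω m
        rw [zero_add, add_comm]
        rfl
      rw [e]
      exact hxη
    | succ n =>
      have h := iIndepFun_indepFun_shift hN.measurable_eta hN.indep_eta (n + 1) (F := η n)
        ((comap_measurable (η n)).mono (le_iSup₂_of_le n (mem_Iio.2 n.lt_succ_self) le_rfl) le_rfl)
      have e : (fun ω m => (inputSeq β η x ω (n + 1 + 1 + m)).1) =
          fun ω m => η (n + 1 + m) ω := by
        ext ω m
        rw [show n + 1 + 1 + m = (n + 1 + m) + 1 by omega]
        rfl
      rw [e]
      exact h
  have hpair : IndepFun (fun ω => (x ω, fun m => η m ω)) (fun ω m => β m ω) μ :=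
    indepFun_prodMk_left_of_right hx hηm hβm (hind.comp measurable_id measurable_swap) hN.indep
  have hcons : Measurable fun (p : V × (ℕ → V)) (m : ℕ) =>
      (Nat.casesOn m p.1 p.2 : V) := by
    refine measurable_pi_lambda _ fun m => ?_
    cases m with
    | zero => exact measurable_fst
    | succ m => exact (measurable_pi_apply m).comp measurable_snd
  have hwβ : IndepFun (fun ω m => (inputSeq β η x ω m).1) (fun ω m => β m ω) μ :=
    hpair.comp hcons measurable_id
  exact iIndepFun_prodMk hwm hN.measurable_beta hw hN.indep_beta hwβ

lemma NoiseAssumption.map_inputSeq_succ (hN : NoiseAssumption μ ι₁ ι₂ κ ρ β η) (m : ℕ) :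
    μ.map (fun ω => inputSeq β η x ω (m + 1)) = (μ.map (η 0)).prod (μ.map (β 0)) := by
  have h : IndepFun (η m) (β (m + 1)) μ :=
    hN.indep.comp (measurable_pi_apply m) (measurable_pi_apply (m + 1))
  rw [indepFun_iff_map_prod_eq_prod_map_map (hN.measurable_eta m).aemeasurable
    (hN.measurable_beta _).aemeasurable, (hN.ident_eta m).map_eq, (hN.ident_beta _).map_eq] at h
  exact h

lemma NoiseAssumption.map_inputSeq_zero (hN : NoiseAssumption μ ι₁ ι₂ κ ρ β η)
    (hx : Measurable x) (hind : IndepOfNoise μ β η x) (hxη : IdentDistrib x (η 0) μ μ) :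
    μ.map (fun ω => inputSeq β η x ω 0) = (μ.map (η 0)).prod (μ.map (β 0)) := by
  have h : IndepFun x (β 0) μ :=
    hind.comp measurable_id ((measurable_pi_apply 0).comp measurable_fst)
  rw [indepFun_iff_map_prod_eq_prod_map_map hx.aemeasurable
    (hN.measurable_beta _).aemeasurable, hxη.map_eq] at h
  exact h

end Noise

end AccretiveJump

end

/-! ### Assembly of the proposition. -/

theorem proposition3p9
    {Ω V V₁ V₂ W : Type*}
    [MeasurableSpace Ω] (μ : Measure Ω) [IsProbabilityMeasure μ] [μ.IsComplete]
    [NormedAddCommGroup V] [NormedSpace ℝ V] [CompleteSpace V]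
    [TopologicalSpace.SeparableSpace V] [MeasurableSpace V] [BorelSpace V]
    [NormedAddCommGroup V₁] [NormedSpace ℝ V₁] [CompleteSpace V₁]
    [TopologicalSpace.SeparableSpace V₁]
    [NormedAddCommGroup V₂] [NormedSpace ℝ V₂] [CompleteSpace V₂]
    [TopologicalSpace.SeparableSpace V₂]
    [NormedAddCommGroup W] [NormedSpace ℝ W] [CompleteSpace W]
    [TopologicalSpace.SeparableSpace W] [MeasurableSpace W] [BorelSpace W]
    (A : Set (V × V)) (hA : IsMAccretive A) (hAd : IsDenselyDefined A)
    (ι₁ : V₁ →L[ℝ] V) (ι₂ : V₂ →L[ℝ] V) (κ ρ : ℝ)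
    (hT : SemigroupAssumption A ι₁ ι₂ κ ρ)
    (β : ℕ → Ω → ℝ) (η : ℕ → Ω → V)
    (hnoise : NoiseAssumption μ ι₁ ι₂ κ ρ β η)
    (Ξ : V → W) (hΞ : IsSubLinear ι₂ Ξ)
    (x : Ω → V) (hx : IsIndepInitial μ ι₁ ι₂ ρ β η x) :
    -- all extinction times are finite and all the integrals exist, almost surely
    (∀ᵐ ω ∂μ, ∀ n : ℕ, extinctionTime A β η x n ω ≠ ⊤ ∧
      IntervalIntegrable (fun τ => Ξ (genProcess A β η x τ ω)) volume
        (extinctionInstant A β η x n ω) (extinctionInstant A β η x (n + 1) ω)) ∧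
    -- the integrals for `n = 1, 2, …` are independent
    iIndepFun (fun (n : ℕ) (ω : Ω) =>
      ∫ τ in (extinctionInstant A β η x (n + 1) ω)..(extinctionInstant A β η x (n + 2) ω),
        Ξ (genProcess A β η x τ ω)) μ ∧
    -- and identically distributed
    (∀ n : ℕ, 1 ≤ n → IdentDistrib
      (fun ω => ∫ τ in (extinctionInstant A β η x n ω)..(extinctionInstant A β η x (n + 1) ω),
        Ξ (genProcess A β η x τ ω))
      (fun ω => ∫ τ in (extinctionInstant A β η x 1 ω)..(extinctionInstant A β η x 2 ω),
        Ξ (genProcess A β η x τ ω)) μ μ) ∧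
    -- with the distribution of the integral up to the first extinction started from a copy of `η₁`
    ∀ xbar : Ω → V, Measurable xbar → IdentDistrib xbar (η 0) μ μ → IndepOfNoise μ β η xbar →
      (∀ᵐ ω ∂μ, extinctionTime A β η xbar 1 ω ≠ ⊤ ∧
        IntervalIntegrable (fun τ => Ξ (genProcess A β η xbar τ ω)) volume
          0 (extinctionInstant A β η xbar 1 ω)) ∧
      ∀ n : ℕ, 1 ≤ n → IdentDistrib
        (fun ω => ∫ τ in (extinctionInstant A β η x n ω)..(extinctionInstant A β η x (n + 1) ω),
          Ξ (genProcess A β η x τ ω))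
        (fun ω => ∫ τ in (0 : ℝ)..(extinctionInstant A β η xbar 1 ω),
          Ξ (genProcess A β η xbar τ ω)) μ μ := by

  have := UniformSpace.secondCountable_of_separable V
  have := UniformSpace.secondCountable_of_separable V₁
  have := UniformSpace.secondCountable_of_separable V₂
  have := UniformSpace.secondCountable_of_separable W
  have hacc := hA.1
  obtain ⟨hr₁, hm₁⟩ := measurableSet_range_and_measurable_subNorm hT.inj₁
  obtain ⟨hr₂, -⟩ := measurableSet_range_and_measurable_subNorm hT.inj₂
  have hcyc : ∀ y : Ω → V, (∀ᵐ ω ∂μ, y ω ∈ range ι₁) → (∀ᵐ ω ∂μ, y ω ∈ range ι₂) →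
      ∀ᵐ ω ∂μ, ∀ n : ℕ, extinctionTime A β η y n ω ≠ ⊤ ∧
        IntervalIntegrable (fun τ => Ξ (genProcess A β η y τ ω)) volume
          (extinctionInstant A β η y n ω) (extinctionInstant A β η y (n + 1) ω) ∧
        ∫ τ in (extinctionInstant A β η y n ω)..(extinctionInstant A β η y (n + 1) ω),
          Ξ (genProcess A β η y τ ω) =
          cycleIntegral A Ξ ((restart (firstExtinction A))^[n] (inputSeq β η y ω)) :=
    fun y h₁ h₂ => (hnoise.isGoodPath hm₁ h₁ h₂).mono fun ω hω n =>
      genProcess_cycle hacc hAd hT hΞ hω n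
  have hcx := hcyc x hx.mem₁ hx.mem₂
  have hNm := measurable_firstExtinction hacc hAd
  have hGm := measurable_cycleIntegral hacc hAd hΞ.measurable
  have hZm := hnoise.measurable_inputSeq hx.measurable
  have hZi := hnoise.iIndepFun_inputSeq hx.measurable hx.indep
  have hpη := Measure.isProbabilityMeasure_map (μ := μ) (hnoise.measurable_eta 0).aemeasurable
  have hpβ := Measure.isProbabilityMeasure_map (μ := μ) (hnoise.measurable_beta 0).aemeasurable
  have hν : ∀ i, 1 ≤ i → μ.map (fun ω => inputSeq β η x ω i) =
      (μ.map (η 0)).prod (μ.map (β 0)) := by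
    intro i hi
    obtain ⟨m, rfl⟩ := Nat.exists_eq_add_of_le' hi
    exact hnoise.map_inputSeq_succ m
  have hpos : ∀ᵐ ω ∂μ, ∀ n,
      0 < firstExtinction A ((restart (firstExtinction A))^[n] (inputSeq β η x ω)) := by
    filter_upwards [hnoise.isGoodPath hm₁ hx.mem₁ hx.mem₂] with ω hω n
    rw [iterate_restart_eq_shift]
    exact hω.firstExtinction_pos hT _
  have hlaw := map_iterate_restart hNm isStopping_firstExtinction hZm hZi hν hpos
  have hYm : ∀ n, Measurable fun ω => (restart (firstExtinction A))^[n] (inputSeq β η x ω) :=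
    fun n => ((measurable_restart hNm).iterate n).comp (measurable_pi_lambda _ hZm)
  -- `Y` will be the once restarted inputs, for identical distribution, and the inputs started from
  -- `xbar`, for the final claim.
  have hident : ∀ {Y : Ω → ℕ → V × ℝ}, Measurable Y →
      μ.map Y = Measure.infinitePi (fun _ => (μ.map (η 0)).prod (μ.map (β 0))) →
      ∀ n, 1 ≤ n → IdentDistrib
        (fun ω => ∫ τ in (extinctionInstant A β η x n ω)..(extinctionInstant A β η x (n + 1) ω),
          Ξ (genProcess A β η x τ ω)) (fun ω => cycleIntegral A Ξ (Y ω)) μ μ := by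
    intro Y hY hYlaw n hn
    obtain ⟨m, rfl⟩ := Nat.exists_eq_add_of_le' hn
    have h1 : IdentDistrib (fun ω => (restart (firstExtinction A))^[m + 1] (inputSeq β η x ω)) Y
        μ μ := ⟨(hYm _).aemeasurable, hY.aemeasurable, (hlaw m).trans hYlaw.symm⟩
    have h2 := h1.comp hGm
    refine (IdentDistrib.of_ae_eq h2.aemeasurable_fst ?_).symm.trans h2
    exact hcx.mono fun ω h => (h (m + 1)).2.2.symm
  refine ⟨hcx.mono fun ω h n => ⟨(h n).1, (h n).2.1⟩, ?_, ?_, ?_⟩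
  · refine (iIndepFun_cycles hNm isStopping_firstExtinction hGm (isStopped_cycleIntegral Ξ)
      hZm hZi hν hpos).congr fun n => ?_
    exact hcx.mono fun ω h => (h (n + 1)).2.2.symm
  · intro n hn
    have h := hident (hYm 1) (hlaw 0)
    exact (h n hn).trans (h 1 le_rfl).symm
  · intro xbar hxm hxd hxi
    -- Membership passes from `η 0` to `xbar` through the common law, as the range is Borel.
    have hb₁ : ∀ᵐ ω ∂μ, xbar ω ∈ range ι₁ :=
      hxd.symm.ae_mem_snd hr₁ (hnoise.eta_mem₁ 0)
    have hb₂ : ∀ᵐ ω ∂μ, xbar ω ∈ range ι₂ :=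
      hxd.symm.ae_mem_snd hr₂ (hnoise.eta_mem₂ 0)
    have hcb := hcyc xbar hb₁ hb₂
    have hbm := hnoise.measurable_inputSeq hxm
    have hblaw : μ.map (inputSeq β η xbar) =
        Measure.infinitePi (fun _ => (μ.map (η 0)).prod (μ.map (β 0))) := by
      have h := map_shift_eq_infinitePi (k := 0)
        (ν := (μ.map (η 0)).prod (μ.map (β 0))) hbm (hnoise.iIndepFun_inputSeq hxm hxi) ?_
      · have e : (fun ω => shift 0 (inputSeq β η xbar ω)) = inputSeq β η xbar := by
          ext ω m <;> simp [shift]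
        rwa [e] at h
      · rintro (_ | m) -
        · exact hnoise.map_inputSeq_zero hxm hxi hxd
        · exact hnoise.map_inputSeq_succ m
    refine ⟨hcb.mono fun ω h => ⟨(h 1).1, ?_⟩, fun n hn => ?_⟩
    · have h0 := (h 0).2.1
      rwa [extinctionInstant_zero] at h0
    · have h1 := hident (measurable_pi_lambda _ hbm) hblaw n hn
      refine h1.trans (IdentDistrib.of_ae_eq h1.aemeasurable_snd (hcb.mono fun ω h => ?_))
      have h0 := (h 0).2.2
      rw [extinctionInstant_zero] at h0
      exact h0.symm
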